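/- Let $\lambda/\mu$ be a border strip, i.e. a connected skew shape containing no $2\times 2$ box. Regard its set of cells $[\lambda/\mu]$ as a poset in which $(i,j)\le(i',j')$ iff $i\ge i'$ and $j\ge j'$ (so the inner corners are the maximal elements). A mobile tree poset $P=P_{\lambda/\mu}(\mathbf p)$ is obtained by letting every cell of the strip cover the roots of finitely many (possibly no) disjoint finite rooted trees, where a rooted tree is a poset in which the root is the maximum and the elements above any given element form a chain. Let $n=|P|$, let $p_{a,b}$ be the total number of vertices of the trees hanging on the cell $(a,b)\in[\lambda/\mu]$, write $v\in\mathbf p$ for the vertices of the hanging trees, and let $h(v)=\#\{w\in P: w\le v\}$ for such a vertex $v$. Let $\omega:P\to[n]$ be a bijection (a labeling $\omega_{\mathrm{inv}}$) such that (1) the labels of the strip decrease along the strip from the bottom left cell to the top right cell (reversed Schur labeling); (2) every hanging tree is naturally labeled: $v<w$ implies $\omega(v)<\omega(w)$; (3) the columns are labeled from right to left, and in each column the hanging trees before the cells: for a cell $(s,t)$ of the strip and a vertex $v$ of a tree hanging on a cell $(a,b)$, one has $\omega(v)<\omega(s,t)$ if and only if $b\ge t$; (4) in each column, the vertices of the trees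 hanging on a cell have smaller labels than those of the trees hanging on any lower cell of the same column; (5) for every tree vertex $v$, the labels of the vertices weakly below $v$ are consecutive integers. Let $e_q^{\mathrm{inv}}(P,\omega)=\sum_f q^{\mathrm{inv}(\omega\circ f^{-1})}$, where $f$ runs over the linear extensions of $P$ (order-preserving bijections $f:P\to[n]$) and $\mathrm{inv}(\sigma)=\#\{(i,j): i<j,\ \sigma_i>\sigma_j\}$. For $(i,j)\in[\lambda]$ put $h(i,j)=\lambda_i-i+\lambda'_j-j+1$ and $h'(i,j)=h(i,j)+\sum_{a\ge i,\,b\ge j}p_{a,b}$. The set $\mathcal E(\lambda/\mu)$ of excited diagrams consists of the sets $D\subseteq[\lambda]$ obtained from $[\mu]$ by sequences of excited moves: if $(i,j)\in D$ and $(i+1,j),(i,j+1),(i+1,j+1)$ all lie in $[\lambda]\setminus D$, replace $(i,j)$ by $(i+1,j+1)$. The broken diagonals $\mathrm{Br}(D)\subseteq[\lambda]\setminus D$ are defined along the moves: $\mathrm{Br}([\mu])$ is the set of $(i,j)\in[\lambda/\mu]$ with $j-i=\mu_t-t$ for some $1\le t\le\ell(\lambda)$ (with $\mu_t=0$ for $t>\ell(\mu)$),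 and the above move replaces $(i+1,j+1)$ by $(i+1,j)$ in it; the result depends only on $D$. Put $$w(D)=\sum_{u\in\mathrm{Br}(D)}h(u),\qquad p_D=\sum_{(i,j)\in[\lambda]\setminus D}\ \sum_{b\ge j}p_{a,b}\;-\sum_{(i,j)\in[\lambda/\mu]}\ \sum_{b\ge j}p_{a,b},$$ where each inner sum is over all $(a,b)\in[\lambda/\mu]$ with $b\ge j$. Then, as rational functions in $q$, $$\frac{e_q^{\mathrm{inv}}(P,\omega)}{\prod_{i=1}^n(1-q^i)}=\prod_{v\in\mathbf p}\frac1{1-q^{h(v)}}\ \sum_{D\in\mathcal E(\lambda/\mu)}q^{\,w(D)+p_D}\prod_{u\in[\lambda]\setminus D}\frac1{1-q^{h'(u)}}.$$ -/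

import Mathlib

noncomputable section

namespace MobileTree

/-! Cells are pairs `(row, column)`, both indexed from `0`, as in `YoungDiagram`. -/

/-! ### Border strips -/

/-- The cells of the skew diagram `[λ/μ]`. -/
def skewCells (lam mu : YoungDiagram) : Finset (ℕ × ℕ) :=
  lam.cells \ mu.cells

/-- `λ/μ` is a border strip: a connected skew shape without a `2 × 2` box. Two cells are adjacent
iff one covers the other in the product order on `ℕ × ℕ`, that is, iff they share an edge. -/
structure IsBorderStrip (lam mu : YoungDiagram) : Prop where
  le : mu ≤ lam
  connected : ((SimpleGraph.hasse (ℕ × ℕ)).induce (skewCells lam mu : Set (ℕ × ℕ))).Connected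
  no_square : ∀ i j : ℕ, ¬ ((i, j) ∈ skewCells lam mu ∧ (i + 1, j) ∈ skewCells lam mu ∧
    (i, j + 1) ∈ skewCells lam mu ∧ (i + 1, j + 1) ∈ skewCells lam mu)

/-! ### Mobile tree posets -/

/-- Rooted trees hanging on the cells of `λ/μ`. The poset `V` is the disjoint union of all the
hanging trees; it is a forest whose roots are the maximal elements (`chain`: the elements above a
given one form a chain), and `cell v` is the cell on which the tree containing `v` hangs. -/
structure HangingTrees (lam mu : YoungDiagram) (V : Type*) [PartialOrder V] where
  chain : ∀ v a b : V, v ≤ a → v ≤ b → a ≤ b ∨ b ≤ a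
  cell : V → ℕ × ℕ
  cell_mem : ∀ v, cell v ∈ skewCells lam mu
  cell_eq : ∀ v w : V, v ≤ w → cell v = cell w

variable {lam mu : YoungDiagram} {V : Type*} [PartialOrder V]

/-- The underlying set of the mobile tree poset: the strip cells and the tree vertices. -/
def Mobile (_T : HangingTrees lam mu V) : Type _ :=
  {c : ℕ × ℕ // c ∈ skewCells lam mu} ⊕ V

/-- A cell of the strip as an element of the mobile tree poset. -/
def Mobile.strip (T : HangingTrees lam mu V) (c : {c : ℕ × ℕ // c ∈ skewCells lam mu}) :
    Mobile T := Sum.inl c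

/-- A vertex of a hanging tree as an element of the mobile tree poset. -/
def Mobile.tree (T : HangingTrees lam mu V) (v : V) : Mobile T := Sum.inr v

instance (T : HangingTrees lam mu V) [Fintype V] : Fintype (Mobile T) :=
  inferInstanceAs (Fintype ({c : ℕ × ℕ // c ∈ skewCells lam mu} ⊕ V))

/-- The order of the mobile tree poset. On the strip, inner corners are maximal, so that the order
is the reverse of the product order on cells; each cell covers the roots of its hanging trees. -/
def Mobile.le (T : HangingTrees lam mu V) : Mobile T → Mobile T → Prop
  | Sum.inl c, Sum.inl d => d.1 ≤ c.1
  | Sum.inr v, Sum.inl c => c.1 ≤ T.cell v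
  | Sum.inr v, Sum.inr w => v ≤ w
  | Sum.inl _, Sum.inr _ => False

instance (T : HangingTrees lam mu V) : PartialOrder (Mobile T) where
  le := Mobile.le T
  le_refl := by
    rintro (c | v)
    · exact le_refl c.1
    · exact le_refl v
  le_trans := by
    rintro (a | a) (b | b) (c | c) hab hbc
    · exact le_trans (α := ℕ × ℕ) hbc hab
    · exact hbc.elim
    · exact hab.elim
    · exact hab.elim
    · exact le_trans (α := ℕ × ℕ) hbc hab
    · exact hbc.elim
    · have h : T.cell a = T.cell b := T.cell_eq a b hab
      change c.1 ≤ T.cell a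
      rw [h]
      exact hbc
    · exact le_trans (α := V) hab hbc
  le_antisymm := by
    rintro (a | a) (b | b) hab hba
    · exact congrArg Sum.inl (Subtype.ext (le_antisymm hba hab))
    · exact hab.elim
    · exact hba.elim
    · exact congrArg Sum.inr (le_antisymm (α := V) hab hba)

/-! ### Linear extensions and the inversion statistic -/

/-- The number of inversions of a permutation. -/
def inversionCount {n : ℕ} (σ : Equiv.Perm (Fin n)) : ℕ :=
  (Finset.univ.filter fun p : Fin n × Fin n => p.1 < p.2 ∧ σ p.2 < σ p.1).card

open Classical in
/-- The linear extensions `ω ∘ f⁻¹` of the labeled poset `(P, ω)`, where `f` runs over the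
order-preserving bijections from `P` to `Fin n`, `n = |P|`. -/
def linearExtensions {P : Type*} [Fintype P] [PartialOrder P]
    (ω : P ≃ Fin (Fintype.card P)) : Finset (Equiv.Perm (Fin (Fintype.card P))) :=
  Finset.univ.filter fun σ =>
    ∃ f : P ≃ Fin (Fintype.card P), Monotone f ∧ σ = f.symm.trans ω

/-- `e_q^inv(P, ω)`, the sum of `q ^ inv σ` over the linear extensions `σ` of `(P, ω)`. -/
def eInv {P : Type*} [Fintype P] [PartialOrder P] (ω : P ≃ Fin (Fintype.card P)) : RatFunc ℚ :=
  ∑ σ ∈ linearExtensions ω, RatFunc.X ^ inversionCount σ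

/-- The labelings `ω_inv` of a mobile tree poset. -/
structure IsInvLabeling [Fintype V] (T : HangingTrees lam mu V)
    (ω : Mobile T ≃ Fin (Fintype.card (Mobile T))) : Prop where
  /-- On the strip the labeling is reversed Schur: labels decrease along the strip from the
  bottom left to the top right. -/
  reversed_schur : ∀ c d : {c : ℕ × ℕ // c ∈ skewCells lam mu},
    (c.1.2 : ℤ) - c.1.1 < (d.1.2 : ℤ) - d.1.1 → ω (Mobile.strip T d) < ω (Mobile.strip T c)
  /-- The trees are naturally labeled. -/
  natural : ∀ v w : V, v < w → ω (Mobile.tree T v) < ω (Mobile.tree T w)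
  /-- The columns are labeled from right to left, in each column the trees before the cells:
  exactly the trees in the columns weakly to the right of a cell have smaller labels than it. -/
  column : ∀ (c : {c : ℕ × ℕ // c ∈ skewCells lam mu}) (v : V),
    ω (Mobile.tree T v) < ω (Mobile.strip T c) ↔ c.1.2 ≤ (T.cell v).2
  /-- Trees in the same column are labeled from top to bottom. -/
  top_to_bottom : ∀ v w : V, (T.cell v).2 = (T.cell w).2 → (T.cell v).1 < (T.cell w).1 →
    ω (Mobile.tree T v) < ω (Mobile.tree T w)
  /-- For every tree vertex `v`, the vertices weakly below `v` have consecutive labels. -/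
  consecutive : ∀ (v : V) (x y z : Mobile T), x ≤ Mobile.tree T v → y ≤ Mobile.tree T v →
    ω x ≤ ω z → ω z ≤ ω y → z ≤ Mobile.tree T v

/-! ### Excited diagrams and broken diagonals -/

/-- The broken diagonals of `D = [μ]`: the cells of `λ/μ` on the diagonals of content `μ_t - t`,
`1 ≤ t ≤ ℓ(λ)` (here `t` is shifted to start from `0`). -/
def initialBroken (lam mu : YoungDiagram) : Finset (ℕ × ℕ) :=
  (skewCells lam mu).filter fun c =>
    ∃ t < lam.colLen 0, (c.2 : ℤ) - c.1 = (mu.rowLen t : ℤ) - (t + 1)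

/-- `Excited lam mu D B`: a sequence of excited moves leads from `[μ]` to `D`, and the corresponding
moves of broken diagonals lead from the broken diagonals of `[μ]` to `B`. -/
inductive Excited (lam mu : YoungDiagram) : Finset (ℕ × ℕ) → Finset (ℕ × ℕ) → Prop
  | base : Excited lam mu mu.cells (initialBroken lam mu)
  | move (D B : Finset (ℕ × ℕ)) (i j : ℕ) : Excited lam mu D B →
      (i, j) ∈ D → (i + 1, j + 1) ∈ lam →
      (i + 1, j) ∉ D → (i, j + 1) ∉ D → (i + 1, j + 1) ∉ D →
      Excited lam mu (insert (i + 1, j + 1) (D.erase (i, j)))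
        (insert (i + 1, j) (B.erase (i + 1, j + 1)))

/-- In a border strip no two distinct cells lie on one diagonal. -/
lemma IsBorderStrip.diagonal (h : IsBorderStrip lam mu) (i j k : ℕ)
    (h1 : (i, j) ∈ skewCells lam mu) (h2 : (i + k + 1, j + k + 1) ∈ skewCells lam mu) : False := by
  simp only [skewCells, Finset.mem_sdiff, YoungDiagram.mem_cells] at h1 h2
  refine h.no_square i j ?_
  simp only [skewCells, Finset.mem_sdiff, YoungDiagram.mem_cells]
  have hl : ∀ a b, a ≤ i + 1 → b ≤ j + 1 → (a, b) ∈ lam := fun a b ha hb =>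
    lam.up_left_mem (by omega) (by omega) h2.1
  have hm : ∀ a b, i ≤ a → j ≤ b → (a, b) ∉ mu := fun a b ha hb hab =>
    h1.2 (mu.up_left_mem ha hb hab)
  exact ⟨⟨hl _ _ (by omega) (by omega), hm _ _ (by omega) (by omega)⟩,
    ⟨hl _ _ (by omega) (by omega), hm _ _ (by omega) (by omega)⟩,
    ⟨hl _ _ (by omega) (by omega), hm _ _ (by omega) (by omega)⟩,
    ⟨hl _ _ (by omega) (by omega), hm _ _ (by omega) (by omega)⟩⟩

lemma Excited.broken_iff (h : IsBorderStrip lam mu) {D B : Finset (ℕ × ℕ)}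
    (hD : Excited lam mu D B) :
    (∀ i j k, (i + k + 1, j + k + 1) ∈ lam → (i, j) ∉ D → (i + k + 1, j + k + 1) ∈ D) ∧
    ∀ a b, (a, b) ∈ B ↔ (a, b) ∈ lam ∧ (a, b) ∉ D ∧ 1 ≤ a ∧ (a - 1, b) ∉ D := by
  induction hD with
  | base =>
    refine ⟨fun i j k h1 h2 => ?_, fun a b => ?_⟩
    · by_contra h3
      refine h.diagonal i j k ?_ ?_
      · simp only [skewCells, Finset.mem_sdiff, YoungDiagram.mem_cells]
        exact ⟨lam.up_left_mem (by omega) (by omega) h1, by simpa using h2⟩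
      · simp only [skewCells, Finset.mem_sdiff, YoungDiagram.mem_cells]
        exact ⟨h1, by simpa using h3⟩
    · simp only [initialBroken, Finset.mem_filter, skewCells, Finset.mem_sdiff,
        YoungDiagram.mem_cells]
      constructor
      · rintro ⟨⟨h1, h2⟩, t, ht, e⟩
        rw [YoungDiagram.mem_iff_lt_rowLen] at h2
        have hta : t < a := by
          by_contra hc
          have := mu.rowLen_anti a t (by omega)
          omega
        refine ⟨h1, by rwa [YoungDiagram.mem_iff_lt_rowLen], by omega, ?_⟩
        rw [YoungDiagram.mem_iff_lt_rowLen]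
        have := mu.rowLen_anti t (a - 1) (by omega)
        omega
      · rintro ⟨h1, h2, h3, h4⟩
        refine ⟨⟨h1, h2⟩, a - 1, ?_, ?_⟩
        · have h5 : (a - 1, 0) ∈ lam := lam.up_left_mem (by omega) (Nat.zero_le b) h1
          rwa [YoungDiagram.mem_iff_lt_colLen] at h5
        · rw [YoungDiagram.mem_iff_lt_rowLen] at h4
          have h6 : mu.rowLen (a - 1) = b := by
            by_contra hc
            refine h.diagonal (a - 1) (b - 1) 0 ?_ ?_
            · simp only [skewCells, Finset.mem_sdiff, YoungDiagram.mem_cells]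
              refine ⟨lam.up_left_mem (by omega) (by omega) h1, ?_⟩
              rw [YoungDiagram.mem_iff_lt_rowLen]
              omega
            · simp only [skewCells, Finset.mem_sdiff, YoungDiagram.mem_cells]
              have e1 : a - 1 + 0 + 1 = a := by omega
              have e2 : b - 1 + 0 + 1 = b := by omega
              rw [e1, e2]
              exact ⟨h1, h2⟩
          simp only [h6]
          omega
  | move D B i j hD h1 h2 h3 h4 h5 ih =>
    obtain ⟨ih1, ih2⟩ := ih
    -- the cell `(i + 1, j + 1)` is the only cell of its diagonal outside `D`
    have below : ∀ k, (i + 1 + k + 1, j + 1 + k + 1) ∈ lam → (i + 1 + k + 1, j + 1 + k + 1) ∈ D :=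
      fun k hk => ih1 _ _ k hk h5
    have above : ∀ a b k, a + k + 1 = i + 1 → b + k + 1 = j + 1 → (a, b) ∈ D := by
      intro a b k ha hb
      by_contra hc
      have := ih1 a b k (by rw [ha, hb]; exact h2) hc
      rw [ha, hb] at this
      exact h5 this
    have up : 1 ≤ i → (i - 1, j) ∈ D := by
      intro hi
      by_contra hc
      have e : i - 1 + 0 + 1 = i := by omega
      have := ih1 (i - 1) j 0 (by rw [e]; exact lam.up_left_mem (by omega) (by omega) h2) hc
      rw [e] at this
      exact h4 this
    have down : (i + 2, j + 1) ∈ lam → (i + 2, j + 1) ∈ D := fun hl => ih1 (i + 1) j 0 hl h3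
    refine ⟨fun a b k hl hn => ?_, fun a b => ?_⟩
    · simp only [Finset.mem_insert, Finset.mem_erase, Prod.mk.injEq, not_or, not_and, ne_eq] at hn ⊢
      by_cases hab : a = i ∧ b = j
      · obtain ⟨rfl, rfl⟩ := hab
        rcases Nat.eq_zero_or_pos k with rfl | hk
        · left; constructor <;> rfl
        · right
          refine ⟨by omega, ?_⟩
          have e1 : a + 1 + (k - 1) + 1 = a + k + 1 := by omega
          have e2 : b + 1 + (k - 1) + 1 = b + k + 1 := by omega
          have := below (k - 1) (by rw [e1, e2]; exact hl)
          rwa [e1, e2] at this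
      · have hn2 : (a, b) ∉ D := hn.2 (by tauto)
        by_cases hij : a + k + 1 = i ∧ b + k + 1 = j
        · exact absurd (above a b (k + 1) (by omega) (by omega)) hn2
        · right
          exact ⟨by tauto, ih1 a b k hl hn2⟩
    · have hD' : ∀ x y, (x, y) ∈ insert (i + 1, j + 1) (D.erase (i, j)) ↔
          (x = i + 1 ∧ y = j + 1) ∨ (¬ (x = i ∧ y = j) ∧ (x, y) ∈ D) := by
        intro x y
        simp [Finset.mem_insert, Finset.mem_erase]
      have hB' : (a, b) ∈ insert (i + 1, j) (B.erase (i + 1, j + 1)) ↔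
          (a = i + 1 ∧ b = j) ∨ (¬ (a = i + 1 ∧ b = j + 1) ∧ (a, b) ∈ B) := by
        simp [Finset.mem_insert, Finset.mem_erase]
      rw [hB', hD', hD', ih2]
      by_cases c1 : a = i + 1 ∧ b = j
      · obtain ⟨rfl, rfl⟩ := c1
        have hl : (i + 1, b) ∈ lam := lam.up_left_mem (by omega) (by omega) h2
        simp [hl, h3]
      by_cases c2 : a = i + 1 ∧ b = j + 1
      · obtain ⟨rfl, rfl⟩ := c2
        simp
      by_cases c3 : a = i ∧ b = j
      · obtain ⟨rfl, rfl⟩ := c3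
        have e : 1 ≤ a → ¬ (a - 1 = a) := by omega
        constructor
        · rintro (h | ⟨-, -, h, -⟩)
          · omega
          · exact absurd h1 h
        · rintro ⟨-, -, h, h'⟩
          exact absurd (Or.inr ⟨by omega, up h⟩) h'
      by_cases c4 : a = i + 2 ∧ b = j + 1
      · obtain ⟨rfl, rfl⟩ := c4
        constructor
        · rintro (h | ⟨-, hl, h, -⟩)
          · omega
          · exact absurd (down hl) h
        · rintro ⟨-, -, -, h'⟩
          exact absurd (Or.inl ⟨by omega, rfl⟩) h'
      have c5 : 1 ≤ a → ¬ (a - 1 = i ∧ b = j) := by omega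
      have c6 : ¬ (a - 1 = i + 1 ∧ b = j + 1) := by omega
      rw [or_iff_right c1, and_iff_right c2, or_iff_right c2, and_iff_right c3, or_iff_right c6]
      constructor
      · rintro ⟨p1, p2, p3, p4⟩
        exact ⟨p1, p2, p3, fun p => p4 p.2⟩
      · rintro ⟨p1, p2, p3, p4⟩
        exact ⟨p1, p2, p3, fun p => p4 ⟨c5 p3, p⟩⟩

/-- The broken diagonals of an excited diagram of a border strip do not depend on the sequence of
excited moves. -/
lemma Excited.unique (h : IsBorderStrip lam mu) {D B B' : Finset (ℕ × ℕ)}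
    (hB : Excited lam mu D B) (hB' : Excited lam mu D B') : B = B' := by
  ext ⟨a, b⟩
  rw [(hB.broken_iff h).2, (hB'.broken_iff h).2]

open Classical in
/-- The set of excited diagrams of `λ/μ`. -/
def excitedDiagrams (lam mu : YoungDiagram) : Finset (Finset (ℕ × ℕ)) :=
  lam.cells.powerset.filter fun D => ∃ B, Excited lam mu D B

open Classical in
/-- The set `Br(D)` of broken diagonals of an excited diagram `D`; for border strips it does not
depend on the sequence of excited moves, see `Excited.unique`. -/
def brokenDiagonals (lam mu : YoungDiagram) (D : Finset (ℕ × ℕ)) : Finset (ℕ × ℕ) :=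
  if h : ∃ B, Excited lam mu D B then h.choose else ∅

/-! ### Hook lengths and weights -/

/-- The hook length `h(i,j)` of a cell of `λ`. -/
def hook (lam : YoungDiagram) (c : ℕ × ℕ) : ℕ :=
  lam.rowLen c.1 + lam.colLen c.2 - c.1 - c.2 - 1

open Classical in
/-- The hook length `h(v)` of a vertex of a hanging tree. -/
def treeHook [Fintype V] (v : V) : ℕ :=
  (Finset.univ.filter fun w : V => w ≤ v).card

/-- The modified hook length `h'(i,j)`: the hook length plus the number of vertices of the trees
that hang on cells weakly to the south-east of `(i,j)`. -/
def mobileHook [Fintype V] (T : HangingTrees lam mu V) (c : ℕ × ℕ) : ℕ :=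
  hook lam c + (Finset.univ.filter fun v : V => c ≤ T.cell v).card

/-- `w(D)`, the sum of the ordinary hook lengths of the broken diagonals of `D`. -/
def weight (lam mu : YoungDiagram) (D : Finset (ℕ × ℕ)) : ℕ :=
  ∑ u ∈ brokenDiagonals lam mu D, hook lam u

/-- The number of vertices of the trees that hang in the columns `b ≥ j`. -/
def treesFrom [Fintype V] (T : HangingTrees lam mu V) (j : ℕ) : ℕ :=
  (Finset.univ.filter fun v : V => j ≤ (T.cell v).2).card

/-- The correction term `p_D`. -/
def correction [Fintype V] (T : HangingTrees lam mu V) (D : Finset (ℕ × ℕ)) : ℤ :=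
  ∑ c ∈ lam.cells \ D, (treesFrom T c.2 : ℤ) - ∑ c ∈ skewCells lam mu, (treesFrom T c.2 : ℤ)

end MobileTree

end

/-! Let c_0, ..., c_n be the cells of the strip from the bottom left to the top right. A step
upwards means c_k < c_{k+1} in P, a step to the right means c_{k+1} < c_k. Both sides of the formula
satisfy the same recursion on the last upward step, up to a fixed power of q.

Poset side. The inversion generating function divided by ∏ (1 - q^i), called `normSum`, is
multiplicative over unrelated sets with separated labels (`normSum_union`) and additive when linear
extensions are sorted by the order of two given elements (`normSum_split`). Take the block labeling
`BlockLt`, where each cell is labeled together with its trees and the labels decrease along the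
strip. If r is the last upward step, the value for the strip plus the value for the strip with step
r turned to the right is the value for the strip cut between c_r and c_{r+1}, hence a product
(`normSum_block_split`). Its second factor, and the initial case without upward steps, are explicit
products (`normSum_block_of_right`): the first cell is a maximum with the largest label, and its
trees contribute by the hook formula for forests (`normSum_forest`).

Path side. Complements of excited diagrams are exactly the lattice paths in λ from c_0 to c_n, and
broken diagonals are the cells from which a path goes up (`isPath_of_excited`, `excited_of_isPath`,
`brokenDiagonals_eq`). The elements of P on cells to the south-east of (i,j) occupy an interval of
positions, from the bottom of column j to the end of row i, so q^{h'(i,j)} = x_i / y_j with x_i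
depending only on the row and y_j only on the column (`mobileHook_add`). For such weights the path
sum can be built column by column and row by row along the strip (`stripState`), and the single
identity `rowSum_nextRow` gives it the recursion found for the poset. Since the recursion determines
a function (`eq_rowSum_stripState`), the two sides agree: `normSum_block_eq` and
`rowSum_stripState`.

Powers of q. The given labeling and the block labeling disagree only on a cell and a tree vertex
hanging lower in its column. Such elements are comparable in P, so every linear extension changes by
the same number of inversions (`normSum_blockLt`). The same number separates w(D) + p_D from the sum
of h' over the upward steps of the path (`exponent_eq`). -/

noncomputable section

namespace MobileTree

/-! ### Normalized inversion generating functions -/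

section NormSum

variable {P K : Type*} [Field K]

open Classical in
/-- The elements of `S` without an `r`-successor in `S`. -/
def maxElems (r : P → P → Prop) (S : Finset P) : Finset P :=
  S.filter fun x => ∀ y ∈ S, ¬ r x y

open Classical in
/-- Auxiliary recursion for `normSum`; the natural number is the cardinality of the set. -/
def normSumAux (q : K) (r I : P → P → Prop) : ℕ → Finset P → K
  | 0, _ => 1
  | n + 1, S => (∑ x ∈ maxElems r S,
      q ^ ((S.erase x).filter (I x)).card * normSumAux q r I n (S.erase x)) / (1 - q ^ (n + 1))

/-- The inversion generating function of the linear extensions of `(S, r)`, divided by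
`∏ (1 - q ^ i)` over `1 ≤ i ≤ |S|`. Here `I x y` says that `y` has a larger label than `x`. -/
def normSum (q : K) (r I : P → P → Prop) (S : Finset P) : K :=
  normSumAux q r I S.card S

variable {q : K} {r I : P → P → Prop} {S : Finset P}

lemma mem_maxElems {x : P} : x ∈ maxElems r S ↔ x ∈ S ∧ ∀ y ∈ S, ¬ r x y := by
  simp [maxElems]

@[simp] lemma normSum_empty : normSum q r I ∅ = 1 := rfl

open Classical in
/-- Removing the last element of a linear extension. -/
lemma normSum_rec (hq : ∀ n, 0 < n → 1 - q ^ n ≠ 0) (hS : S.Nonempty) :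
    (1 - q ^ S.card) * normSum q r I S = ∑ x ∈ maxElems r S,
      q ^ ((S.erase x).filter (I x)).card * normSum q r I (S.erase x) := by
  obtain ⟨n, hn⟩ : ∃ n, S.card = n + 1 := ⟨S.card - 1, by have := hS.card_pos; omega⟩
  have h := hq (n + 1) (by omega)
  rw [normSum, hn, normSumAux, mul_div_cancel₀ _ h]
  refine Finset.sum_congr rfl fun x hx => ?_
  have : (S.erase x).card = n := by
    rw [Finset.card_erase_of_mem (mem_maxElems.1 hx).1, hn]; rfl
  rw [normSum, this]

open Classical in
lemma normSum_rec_ite (hq : ∀ n, 0 < n → 1 - q ^ n ≠ 0) (hS : S.Nonempty) :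
    (1 - q ^ S.card) * normSum q r I S = ∑ x ∈ S, if ∀ y ∈ S, ¬ r x y then
      q ^ ((S.erase x).filter (I x)).card * normSum q r I (S.erase x) else 0 := by
  rw [normSum_rec hq hS, maxElems, Finset.sum_filter]

lemma normSum_congr (hq : ∀ n, 0 < n → 1 - q ^ n ≠ 0) {r' I' : P → P → Prop}
    (hr : ∀ x ∈ S, ∀ y ∈ S, (r x y ↔ r' x y)) (hI : ∀ x ∈ S, ∀ y ∈ S, (I x y ↔ I' x y)) :
    normSum q r I S = normSum q r' I' S := by
  classical
  induction hn : S.card generalizing S with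
  | zero => rw [Finset.card_eq_zero.1 hn]; simp
  | succ n ih =>
    have hS : S.Nonempty := Finset.card_pos.1 (by omega)
    apply mul_left_cancel₀ (hq S.card (by omega))
    rw [normSum_rec_ite hq hS, normSum_rec_ite hq hS]
    refine Finset.sum_congr rfl fun x hx => ?_
    have h1 : (∀ y ∈ S, ¬ r x y) ↔ (∀ y ∈ S, ¬ r' x y) :=
      forall₂_congr fun y hy => not_congr (hr x hx y hy)
    have h2 : (S.erase x).filter (I x) = (S.erase x).filter (I' x) :=
      Finset.filter_congr fun y hy => hI x hx y (Finset.mem_of_mem_erase hy)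
    rw [h2, ih (fun a ha b hb => hr a (Finset.mem_of_mem_erase ha) b (Finset.mem_of_mem_erase hb))
      (fun a ha b hb => hI a (Finset.mem_of_mem_erase ha) b (Finset.mem_of_mem_erase hb))
      (by rw [Finset.card_erase_of_mem hx, hn]; rfl)]
    simp only [h1]

open Classical in
/-- The generating function of a disjoint union of unrelated sets, all labels in the first set
being smaller than those in the second one. -/
lemma normSum_union (hq : ∀ n, 0 < n → 1 - q ^ n ≠ 0) {A B : Finset P}
    (hr : ∀ x ∈ A, ∀ y ∈ B, ¬ r x y ∧ ¬ r y x) (hI : ∀ x ∈ A, ∀ y ∈ B, I x y ∧ ¬ I y x)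
    (hd : Disjoint A B) :
    normSum q r I (A ∪ B) = normSum q r I A * normSum q r I B := by
  induction hn : (A ∪ B).card generalizing A B with
  | zero =>
    have h := Finset.union_eq_empty.1 (Finset.card_eq_zero.1 hn)
    rw [h.1, h.2]; simp
  | succ n ih =>
    rcases A.eq_empty_or_nonempty with rfl | hA
    · simp
    rcases B.eq_empty_or_nonempty with rfl | hB
    · simp
    apply mul_left_cancel₀ (hq (A ∪ B).card (by omega))
    have hAB : (A ∪ B).card = A.card + B.card := Finset.card_union_of_disjoint hd
    -- The two summands match the two possibilities for the last element. If it lies in `A`, it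
    -- forms an inversion with every element of `B`, whence the factor `q ^ B.card`; if it lies in
    -- `B`, it forms none with `A`.
    have e1 : (1 - q ^ (A ∪ B).card) * (normSum q r I A * normSum q r I B) =
        q ^ B.card * ((1 - q ^ A.card) * normSum q r I A) * normSum q r I B +
          normSum q r I A * ((1 - q ^ B.card) * normSum q r I B) := by
      rw [hAB, pow_add]; ring
    rw [e1, normSum_rec_ite hq hA, normSum_rec_ite hq hB, normSum_rec_ite hq (hA.mono (by simp)),
      Finset.sum_union hd, Finset.mul_sum, Finset.sum_mul, Finset.mul_sum]
    congr 1
    · refine Finset.sum_congr rfl fun x hx => ?_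
      have hxB : x ∉ B := Finset.disjoint_left.1 hd hx
      have h1 : (∀ y ∈ A ∪ B, ¬ r x y) ↔ (∀ y ∈ A, ¬ r x y) :=
        ⟨fun h y hy => h y (Finset.mem_union_left _ hy), fun h y hy =>
          (Finset.mem_union.1 hy).elim (h y) fun hy => (hr x hx y hy).1⟩
      have h2 : (A ∪ B).erase x = A.erase x ∪ B := by
        rw [Finset.erase_union_distrib, Finset.erase_eq_of_notMem hxB]
      have h3 : ((A.erase x ∪ B).filter (I x)).card =
          ((A.erase x).filter (I x)).card + B.card := by
        rw [Finset.filter_union, Finset.filter_true_of_mem (s := B) fun y hy => (hI x hx y hy).1,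
          Finset.card_union_of_disjoint]
        exact Finset.disjoint_of_subset_left
          ((Finset.filter_subset _ _).trans (Finset.erase_subset _ _)) hd
      have h4 := ih (A := A.erase x) (B := B)
        (fun a ha => hr a (Finset.mem_of_mem_erase ha))
        (fun a ha => hI a (Finset.mem_of_mem_erase ha))
        (Finset.disjoint_of_subset_left (Finset.erase_subset _ _) hd)
        (by rw [← h2, Finset.card_erase_of_mem (Finset.mem_union_left _ hx), hn]; rfl)
      simp only [h1]
      split_ifs
      · rw [h2, h3, h4, pow_add]; ring
      · ring
    · refine Finset.sum_congr rfl fun x hx => ?_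
      have hxA : x ∉ A := Finset.disjoint_right.1 hd hx
      have h1 : (∀ y ∈ A ∪ B, ¬ r x y) ↔ (∀ y ∈ B, ¬ r x y) :=
        ⟨fun h y hy => h y (Finset.mem_union_right _ hy), fun h y hy =>
          (Finset.mem_union.1 hy).elim (fun hy => (hr y hy x hx).2) (h y)⟩
      have h2 : (A ∪ B).erase x = A ∪ B.erase x := by
        rw [Finset.erase_union_distrib, Finset.erase_eq_of_notMem hxA]
      have h3 : (A ∪ B.erase x).filter (I x) = (B.erase x).filter (I x) := by
        rw [Finset.filter_union, Finset.filter_false_of_mem (s := A) fun y hy => (hI y hy x hx).2,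
          Finset.empty_union]
      have h4 := ih (A := A) (B := B.erase x)
        (fun a ha b hb => hr a ha b (Finset.mem_of_mem_erase hb))
        (fun a ha b hb => hI a ha b (Finset.mem_of_mem_erase hb))
        (Finset.disjoint_of_subset_right (Finset.erase_subset _ _) hd)
        (by rw [← h2, Finset.card_erase_of_mem (Finset.mem_union_right _ hx), hn]; rfl)
      simp only [h1]
      split_ifs
      · rw [h2, h3, h4]; ring
      · ring

/-- Splitting the linear extensions according to the order of two elements `a` and `b`. -/
lemma normSum_split (hq : ∀ n, 0 < n → 1 - q ^ n ≠ 0) {r₁ r₂ : P → P → Prop} {a b : P}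
    (hab : a ≠ b) (h₁ : ∀ x y, r₁ x y ↔ r x y ∨ (x = a ∧ y = b))
    (h₂ : ∀ x y, r₂ x y ↔ r x y ∨ (x = b ∧ y = a)) (ha : a ∈ S) (hb : b ∈ S) :
    normSum q r I S = normSum q r₁ I S + normSum q r₂ I S := by
  classical
  induction hn : S.card generalizing S with
  | zero => rw [Finset.card_eq_zero.1 hn] at ha; simp at ha
  | succ n ih =>
    have hS : S.Nonempty := ⟨a, ha⟩
    apply mul_left_cancel₀ (hq S.card (by omega))
    rw [mul_add, normSum_rec_ite hq hS, normSum_rec_ite hq hS, normSum_rec_ite hq hS,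
      ← Finset.sum_add_distrib]
    refine Finset.sum_congr rfl fun x hx => ?_
    by_cases hxa : x = a
    · subst hxa
      -- An extension ending in `a` has `b` before `a`, so it is counted by `r₂` only; once `a` is
      -- erased, `r` and `r₂` agree.
      have e1 : ¬ ∀ y ∈ S, ¬ r₁ x y := fun h => h b hb ((h₁ _ _).2 (Or.inr ⟨rfl, rfl⟩))
      have e2 : (∀ y ∈ S, ¬ r₂ x y) ↔ ∀ y ∈ S, ¬ r x y := by simp [h₂, hab]
      have e3 : normSum q r I (S.erase x) = normSum q r₂ I (S.erase x) := by
        refine normSum_congr hq (fun u hu v hv => ?_) fun _ _ _ _ => Iff.rfl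
        simp [h₂, Finset.ne_of_mem_erase hv]
      rw [if_neg e1, zero_add, e3]
      simp only [e2]
    by_cases hxb : x = b
    · subst hxb
      have e1 : ¬ ∀ y ∈ S, ¬ r₂ x y := fun h => h a ha ((h₂ _ _).2 (Or.inr ⟨rfl, rfl⟩))
      have e2 : (∀ y ∈ S, ¬ r₁ x y) ↔ ∀ y ∈ S, ¬ r x y := by simp [h₁, hxa]
      have e3 : normSum q r I (S.erase x) = normSum q r₁ I (S.erase x) := by
        refine normSum_congr hq (fun u hu v hv => ?_) fun _ _ _ _ => Iff.rfl
        simp [h₁, Finset.ne_of_mem_erase hv]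
      rw [if_neg e1, add_zero, e3]
      simp only [e2]
    · have e1 : (∀ y ∈ S, ¬ r₁ x y) ↔ ∀ y ∈ S, ¬ r x y := by simp [h₁, hxa]
      have e2 : (∀ y ∈ S, ¬ r₂ x y) ↔ ∀ y ∈ S, ¬ r x y := by simp [h₂, hxb]
      have e3 := ih (S := S.erase x) (Finset.mem_erase.2 ⟨Ne.symm hxa, ha⟩)
        (Finset.mem_erase.2 ⟨Ne.symm hxb, hb⟩) (by rw [Finset.card_erase_of_mem hx, hn]; rfl)
      simp only [e1, e2, e3]
      split_ifs <;> ring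

open Classical in
/-- A set with a single maximal element, which carries the largest label. -/
lemma normSum_of_top (hq : ∀ n, 0 < n → 1 - q ^ n ≠ 0) {x : P} (hx : x ∈ S)
    (hr : ∀ y ∈ S, (∀ z ∈ S, ¬ r y z) ↔ y = x) (hI : ∀ y ∈ S, ¬ I x y) :
    normSum q r I S = 1 / (1 - q ^ S.card) * normSum q r I (S.erase x) := by
  have h := hq S.card (Finset.card_pos.2 ⟨x, hx⟩)
  have e : maxElems r S = {x} := by
    ext y
    rw [mem_maxElems, Finset.mem_singleton]
    exact ⟨fun hy => (hr y hy.1).1 hy.2, fun hy => hy ▸ ⟨hx, (hr x hx).2 rfl⟩⟩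
  apply mul_left_cancel₀ h
  rw [normSum_rec hq ⟨x, hx⟩, e, Finset.sum_singleton,
    Finset.filter_false_of_mem fun y hy => hI y (Finset.mem_of_mem_erase hy)]
  field_simp
  simp

/-- Replacing a strict order by a relation that generates it. -/
lemma normSum_lt_eq [PartialOrder P] (hq : ∀ n, 0 < n → 1 - q ^ n ≠ 0)
    (h₁ : ∀ x y, r x y → x < y) (h₂ : ∀ x y, x < y → ∃ z, r x z ∧ z ≤ y)
    (hS : ∀ x y, x ≤ y → y ∈ S → x ∈ S) :
    normSum q (· < ·) I S = normSum q r I S := by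
  classical
  induction hn : S.card generalizing S with
  | zero => rw [Finset.card_eq_zero.1 hn]; simp
  | succ n ih =>
    have hne : S.Nonempty := Finset.card_pos.1 (by omega)
    apply mul_left_cancel₀ (hq S.card (by omega))
    rw [normSum_rec_ite hq hne, normSum_rec_ite hq hne]
    refine Finset.sum_congr rfl fun x hx => ?_
    have e1 : (∀ y ∈ S, ¬ x < y) ↔ (∀ y ∈ S, ¬ r x y) := by
      refine ⟨fun h y hy hxy => h y hy (h₁ _ _ hxy), fun h y hy hxy => ?_⟩
      obtain ⟨z, hz, hzy⟩ := h₂ _ _ hxy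
      exact h z (hS z y hzy hy) hz
    -- Only maximal elements are erased, which keeps the set closed downwards, as the induction
    -- hypothesis requires.
    by_cases hm : ∀ y ∈ S, ¬ x < y
    · have e2 := ih (S := S.erase x) (fun u v huv hv => by
        rw [Finset.mem_erase] at hv ⊢
        refine ⟨?_, hS u v huv hv.2⟩
        rintro rfl
        exact hm v hv.2 (lt_of_le_of_ne huv (Ne.symm hv.1)))
        (by rw [Finset.card_erase_of_mem hx, hn]; rfl)
      rw [if_pos hm, if_pos (e1.1 hm), e2]
    · rw [if_neg hm, if_neg (fun h => hm (e1.2 h))]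

open Classical in
/-- Changing the relative labels of comparable elements multiplies the generating function by a
power of `q`. -/
lemma normSum_change_labels [PartialOrder P] (hq : ∀ n, 0 < n → 1 - q ^ n ≠ 0) {J : P → P → Prop}
    (h₁ : ∀ x y, ¬ x < y → I x y → J x y) (h₂ : ∀ x y, ¬ x < y → J x y → ¬ I x y → y < x) :
    normSum q (· < ·) J S =
      q ^ (∑ x ∈ S, (S.filter fun y => y < x ∧ J x y ∧ ¬ I x y).card) *
        normSum q (· < ·) I S := by
  induction hn : S.card generalizing S with
  | zero => rw [Finset.card_eq_zero.1 hn]; simp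
  | succ n ih =>
    have hne : S.Nonempty := Finset.card_pos.1 (by omega)
    apply mul_left_cancel₀ (hq S.card (by omega))
    rw [mul_left_comm, normSum_rec_ite hq hne, normSum_rec_ite hq hne, Finset.mul_sum]
    refine Finset.sum_congr rfl fun x hx => ?_
    split_ifs with hm
    · rw [ih (by rw [Finset.card_erase_of_mem hx, hn]; rfl), ← mul_assoc, ← mul_assoc, ← pow_add,
        ← pow_add]
      congr 2
      rw [← Finset.add_sum_erase S _ hx]
      have e1 : ∀ u ∈ S.erase x, (S.filter fun y => y < u ∧ J u y ∧ ¬ I u y) =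
          (S.erase x).filter fun y => y < u ∧ J u y ∧ ¬ I u y := by
        intro u hu
        ext y
        simp only [Finset.mem_filter, Finset.mem_erase]
        refine ⟨fun h => ⟨⟨?_, h.1⟩, h.2⟩, fun h => ⟨h.1.2, h.2⟩⟩
        rintro rfl
        exact hm u (Finset.mem_of_mem_erase hu) h.2.1
      rw [Finset.sum_congr rfl fun u hu => congrArg Finset.card (e1 u hu)]
      -- As `x` comes last, every element below it precedes it, so the extra `J`-inversions of `x`
      -- do not depend on the extension.
      have e2 : ((S.erase x).filter (J x)).card = ((S.erase x).filter (I x)).card +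
          (S.filter fun y => y < x ∧ J x y ∧ ¬ I x y).card := by
        rw [← Finset.card_union_of_disjoint]
        · congr 1
          ext y
          simp only [Finset.mem_union, Finset.mem_filter, Finset.mem_erase]
          constructor
          · rintro ⟨⟨h3, h4⟩, h5⟩
            by_cases h6 : I x y
            · exact Or.inl ⟨⟨h3, h4⟩, h6⟩
            · exact Or.inr ⟨h4, h₂ _ _ (hm y h4) h5 h6, h5, h6⟩
          · rintro (⟨⟨h3, h4⟩, h5⟩ | ⟨h4, h5, h6, h7⟩)
            · exact ⟨⟨h3, h4⟩, h₁ _ _ (hm y h4) h5⟩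
            · exact ⟨⟨h5.ne, h4⟩, h6⟩
        · rw [Finset.disjoint_left]
          intro y hy hy'
          exact (Finset.mem_filter.1 hy').2.2.2 (Finset.mem_filter.1 hy).2
      rw [e2]; ring
    · simp

open Classical in
/-- The hook formula for forests whose labeling is natural and has consecutive labels on
principal ideals. -/
lemma normSum_forest [PartialOrder P] (hq : ∀ n, 0 < n → 1 - q ^ n ≠ 0) {ω : P → ℕ}
    (hchain : ∀ v ∈ S, ∀ a ∈ S, ∀ b ∈ S, v ≤ a → v ≤ b → a ≤ b ∨ b ≤ a)
    (hnat : ∀ v ∈ S, ∀ w ∈ S, v < w → ω v < ω w)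
    (hcons : ∀ v ∈ S, ∀ x ∈ S, ∀ y ∈ S, ∀ z ∈ S, x ≤ v → y ≤ v → ω x ≤ ω z → ω z ≤ ω y → z ≤ v) :
    normSum q (· < ·) (fun x y => ω x < ω y) S =
      ∏ v ∈ S, 1 / (1 - q ^ (S.filter (· ≤ v)).card) := by
  induction hn : S.card using Nat.strong_induction_on generalizing S with
  | _ n ih =>
    rcases S.eq_empty_or_nonempty with rfl | hS
    · simp
    have sub : ∀ R ⊆ S, R.card < n → (∀ v ∈ R, ∀ w ∈ S, w ≤ v → w ∈ R) →
        normSum q (· < ·) (fun x y => ω x < ω y) R =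
          ∏ v ∈ R, 1 / (1 - q ^ (S.filter (· ≤ v)).card) := by
      intro R hR hc hl
      rw [ih _ hc (fun v hv a ha b hb => hchain v (hR hv) a (hR ha) b (hR hb))
        (fun v hv w hw => hnat v (hR hv) w (hR hw))
        (fun v hv x hx y hy z hz => hcons v (hR hv) x (hR hx) y (hR hy) z (hR hz)) rfl]
      refine Finset.prod_congr rfl fun v hv => ?_
      have : R.filter (· ≤ v) = S.filter (· ≤ v) := by
        ext w
        simp only [Finset.mem_filter]
        exact ⟨fun h => ⟨hR h.1, h.2⟩, fun h => ⟨hl v hv w h.1 h.2, h.2⟩⟩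
      rw [this]
    -- The element with the largest label is a root because the labeling is natural. Either its tree
    -- is everything and the root is removed, or its tree is split off from the rest.
    obtain ⟨x, hx, hmax⟩ := S.exists_max_image ω hS
    have hxmax : ∀ v ∈ S, x ≤ v → v = x := fun v hv hxv => by
      by_contra hne
      exact absurd (hnat x hx v hv (lt_of_le_of_ne hxv (Ne.symm hne))) (not_lt.2 (hmax v hv))
    by_cases hB : S.filter (· ≤ x) = S
    · have hle : ∀ y ∈ S, y ≤ x := Finset.filter_eq_self.1 hB
      rw [normSum_of_top hq hx, sub (S.erase x), ← Finset.mul_prod_erase S _ hx, hB]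
      · exact Finset.erase_subset _ _
      · rw [Finset.card_erase_of_mem hx, ← hn]
        have := hS.card_pos
        omega
      · intro v hv w hw hwv
        rw [Finset.mem_erase] at hv ⊢
        refine ⟨?_, hw⟩
        rintro rfl
        exact hv.1 (hxmax v hv.2 hwv)
      · intro y hy
        constructor
        · intro h
          by_contra hne
          exact h x hx (lt_of_le_of_ne (hle y hy) hne)
        · rintro rfl z hz hlt
          exact hlt.ne (hxmax z hz hlt.le).symm
      · exact fun y hy => not_lt.2 (hmax y hy)
    · have hc := Finset.card_filter_add_card_filter_not (s := S) (· ≤ x)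
      have hA : 0 < (S.filter (· ≤ x)).card :=
        Finset.card_pos.2 ⟨x, Finset.mem_filter.2 ⟨hx, le_rfl⟩⟩
      have hA' : (S.filter (· ≤ x)).card < S.card :=
        Finset.card_lt_card ((Finset.filter_subset _ _).ssubset_of_ne hB)
      have hd : Disjoint (S.filter fun y => ¬ y ≤ x) (S.filter (· ≤ x)) :=
        (Finset.disjoint_filter_filter_not _ _ _).symm
      have hU : (S.filter fun y => ¬ y ≤ x) ∪ S.filter (· ≤ x) = S := by
        rw [Finset.union_comm, Finset.filter_union_filter_not_eq]
      have key : normSum q (· < ·) (fun x y => ω x < ω y)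
          ((S.filter fun y => ¬ y ≤ x) ∪ S.filter (· ≤ x)) = _ := normSum_union hq ?_ ?_ hd
      · rw [hU] at key
        rw [key, sub _ (Finset.filter_subset _ _) (by omega), sub _ (Finset.filter_subset _ _)
          (by omega), ← Finset.prod_union hd, hU]
        · intro v hv w hw hwv
          exact Finset.mem_filter.2 ⟨hw, hwv.trans (Finset.mem_filter.1 hv).2⟩
        · intro v hv w hw hwv
          rw [Finset.mem_filter] at hv ⊢
          refine ⟨hw, fun hwx => ?_⟩
          rcases hchain w hw v hv.1 x hx hwv hwx with h | h
          · exact hv.2 h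
          · exact hv.2 (hxmax v hv.1 h).le
      · intro a ha b hb
        rw [Finset.mem_filter] at ha hb
        refine ⟨fun h => ha.2 (h.le.trans hb.2), fun h => ?_⟩
        rcases hchain b hb.1 a ha.1 x hx h.le hb.2 with h | h
        · exact ha.2 h
        · exact ha.2 (hxmax a ha.1 h).le
      · intro a ha b hb
        rw [Finset.mem_filter] at ha hb
        -- The tree of `x` carries consecutive labels up to the maximum, so every element outside it
        -- has a smaller label.
        have hlt : ω a < ω b := by
          by_contra hcon
          exact ha.2 (hcons x hx b hb.1 x hx a ha.1 hb.2 le_rfl (not_lt.1 hcon) (hmax a ha.1))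
        exact ⟨hlt, hlt.asymm⟩

end NormSum

/-! ### Path sums along a strip -/

section PathSum

variable {K : Type*} [Field K]

/-- The sum over lattice paths that end in the row with parameter `x` at the first column of the
list. An entry `(y, p)` stands for a column with parameter `y` that is entered from below with
total weight `p`; the columns are listed from right to left. -/
def rowSum (x : K) : List (K × K) → K
  | [] => 0
  | (y, p) :: l => (rowSum x l + p) / (1 - x / y)

/-- The weights with which the columns leave the row with parameter `x` upwards. -/
def nextRow (x : K) : List (K × K) → List (K × K)
  | [] => []
  | (y, p) :: l => (y, rowSum x ((y, p) :: l) * (x / y)) :: nextRow x l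

/-- This is the identity behind the recursion for path sums. It rests on (1 - X/x)(x/y) = (1 - X/y)
- (1 - x/y), which needs the weight of a cell to be a quotient of a row parameter by a column
parameter. After division by 1 - X/x, the two terms on the left are the states following a step
upwards and a step to the right, where `x` serves once as row parameter and once as parameter of the
new column. -/
lemma rowSum_nextRow {x X : K} (hx : x ≠ 0) (l : List (K × K))
    (hl : ∀ p ∈ l, p.1 ≠ 0 ∧ 1 - x / p.1 ≠ 0 ∧ 1 - X / p.1 ≠ 0) :
    (1 - X / x) * rowSum X (nextRow x l) + rowSum X l = rowSum x l := by
  induction l with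
  | nil => simp [rowSum, nextRow]
  | cons a l ih =>
    obtain ⟨y, p⟩ := a
    have ih := ih fun b hb => hl b (List.mem_cons_of_mem _ hb)
    obtain ⟨hy, h1, h2⟩ := hl (y, p) List.mem_cons_self
    have e1 : rowSum x ((y, p) :: l) * (1 - x / y) = rowSum x l + p := by
      rw [rowSum, div_mul_cancel₀ _ h1]
    have e2 : (1 - X / x) * (x / y) = (1 - X / y) - (1 - x / y) := by
      field_simp; ring
    rw [nextRow]
    generalize hf : rowSum x ((y, p) :: l) = f at e1 ⊢
    rw [rowSum, rowSum, ← mul_div_assoc, ← add_div, div_eq_iff h2]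
    linear_combination ih + f * e2 - e1

variable (y : ℕ → K)

open Classical in
/-- The state of the path sum along a strip after `n` steps; `U` is the set of upward steps. -/
def stripState (U : Finset ℕ) : ℕ → List (K × K)
  | 0 => [(y 0, 1)]
  | n + 1 => if n ∈ U then nextRow (y (n + 1)) (stripState U n)
      else (y (n + 1), 0) :: stripState U n

variable {y}

lemma fst_mem_nextRow {x : K} {l : List (K × K)} {p : K × K} (hp : p ∈ nextRow x l) :
    ∃ p' ∈ l, p'.1 = p.1 := by
  induction l with
  | nil => simp [nextRow] at hp
  | cons a l ih =>
    obtain ⟨b, c⟩ := a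
    rw [nextRow, List.mem_cons] at hp
    rcases hp with rfl | hp
    · exact ⟨(b, c), List.mem_cons_self, rfl⟩
    · obtain ⟨p', h, h'⟩ := ih hp
      exact ⟨p', List.mem_cons_of_mem _ h, h'⟩

lemma fst_mem_stripState {U : Finset ℕ} {n : ℕ} {p : K × K} (hp : p ∈ stripState y U n) :
    ∃ k ≤ n, p.1 = y k := by
  induction n generalizing p with
  | zero =>
    rw [stripState, List.mem_singleton] at hp
    exact ⟨0, le_rfl, by rw [hp]⟩
  | succ n ih =>
    rw [stripState] at hp
    split_ifs at hp
    · obtain ⟨p', h, h'⟩ := fst_mem_nextRow hp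
      obtain ⟨k, hk, e⟩ := ih h
      exact ⟨k, by omega, by rw [← h', e]⟩
    · rw [List.mem_cons] at hp
      rcases hp with rfl | hp
      · exact ⟨n + 1, le_rfl, rfl⟩
      · obtain ⟨k, hk, e⟩ := ih hp
        exact ⟨k, by omega, e⟩

lemma stripState_congr {U U' : Finset ℕ} {n : ℕ} (h : ∀ k < n, (k ∈ U ↔ k ∈ U')) :
    stripState y U n = stripState y U' n := by
  induction n with
  | zero => rfl
  | succ n ih =>
    rw [stripState, stripState, ih fun k hk => h k (by omega)]
    simp only [h n (by omega)]

lemma rowSum_stripState_of_forall_notMem {U : Finset ℕ} {n : ℕ} (X : K) (hU : ∀ k < n, k ∉ U) :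
    rowSum X (stripState y U n) = ∏ k ∈ Finset.range (n + 1), 1 / (1 - X / y k) := by
  induction n with
  | zero => simp [stripState, rowSum]
  | succ n ih =>
    rw [Finset.prod_range_succ, ← ih fun k hk => hU k (by omega), stripState,
      if_neg (hU n (by omega)), rowSum]
    ring

/-- Replacing the last upward step by a step to the right. -/
lemma rowSum_stripState_erase {U : Finset ℕ} {r n : ℕ} {X : K} (hr : r ∈ U) (hn : r < n)
    (hU : ∀ k, r < k → k < n → k ∉ U) (hy : ∀ k ≤ r + 1, y k ≠ 0)
    (h1 : ∀ k ≤ r, 1 - y (r + 1) / y k ≠ 0) (h2 : ∀ k ≤ r + 1, 1 - X / y k ≠ 0) :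
    rowSum X (stripState y U n) + rowSum X (stripState y (U.erase r) n) =
      rowSum (y (r + 1)) (stripState y U r) *
        ∏ k ∈ Finset.Ico (r + 1) (n + 1), 1 / (1 - X / y k) := by
  induction n, hn using Nat.le_induction with
  | base =>
    have e1 : stripState y (U.erase r) r = stripState y U r :=
      stripState_congr fun k hk => by simp [hk.ne]
    have key := rowSum_nextRow (x := y (r + 1)) (X := X) (hy _ le_rfl) (stripState y U r) (by
      intro p hp
      obtain ⟨k, hk, e⟩ := fst_mem_stripState hp
      rw [e]
      exact ⟨hy k (by omega), h1 k hk, h2 k (by omega)⟩)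
    have h3 := h2 (r + 1) le_rfl
    rw [stripState, if_pos hr, stripState, if_neg (by simp), rowSum, e1, add_zero, ← key]
    simp only [Nat.succ_eq_add_one, Nat.Ico_succ_singleton, Finset.prod_singleton]
    rw [mul_one_div, eq_div_iff h3, add_mul, div_mul_cancel₀ _ h3]
    ring
  -- All later steps go to the right and open columns of entry weight `0`, so each of them divides
  -- both sums by the same factor.
  | succ n hn ih =>
    rw [Finset.prod_Ico_succ_top (by omega), ← mul_assoc,
      ← ih fun k hk hk' => hU k hk (by omega), stripState,
      if_neg (hU n (by omega) (by omega)), stripState,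
      if_neg (fun h => hU n (by omega) (by omega) (Finset.mem_of_mem_erase h)), rowSum, rowSum]
    ring

/-- The path sum is characterized by its values on strips without upward steps and by the effect
of replacing the last upward step by a step to the right. -/
lemma eq_rowSum_stripState {N : ℕ} (hy : ∀ k ≤ N, y k ≠ 0)
    (hyy : ∀ k l, k < l → l ≤ N → 1 - y l / y k ≠ 0) (G : Finset ℕ → ℕ → K)
    (h0 : ∀ U n, n < N → (∀ k < n, k ∉ U) →
      G U n = ∏ k ∈ Finset.range (n + 1), 1 / (1 - y (n + 1) / y k))
    (h1 : ∀ U n r, n < N → r < n → r ∈ U → (∀ k, r < k → k < n → k ∉ U) →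
      G U n + G (U.erase r) n =
        G U r * ∏ k ∈ Finset.Ico (r + 1) (n + 1), 1 / (1 - y (n + 1) / y k))
    (U : Finset ℕ) (n : ℕ) (hn : n < N) :
    G U n = rowSum (y (n + 1)) (stripState y U n) := by
  classical
  -- The induction is on the number of upward steps before `n`: cutting at the last one, or turning
  -- it to the right, lowers this number.
  induction hc : (U.filter (· < n)).card using Nat.strong_induction_on generalizing U n with
  | _ c ih =>
    subst hc
    rcases (U.filter (· < n)).eq_empty_or_nonempty with he | hne
    · have hU : ∀ k < n, k ∉ U := fun k hk hkU => by
        have : k ∈ U.filter (· < n) := Finset.mem_filter.2 ⟨hkU, hk⟩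
        simp [he] at this
      rw [h0 U n hn hU, rowSum_stripState_of_forall_notMem _ hU]
    · obtain ⟨r, hr, hmax⟩ := (U.filter (· < n)).exists_max_image id hne
      obtain ⟨hrU, hrn⟩ := Finset.mem_filter.1 hr
      have hU : ∀ k, r < k → k < n → k ∉ U := fun k hk hkn hkU =>
        absurd (hmax k (Finset.mem_filter.2 ⟨hkU, hkn⟩)) (not_le.2 hk)
      have i1 := ih _ (Finset.card_lt_card (Finset.ssubset_iff_subset_ne.2
        ⟨fun k hk => by
          rw [Finset.mem_filter] at hk ⊢
          exact ⟨hk.1, by omega⟩, fun h => by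
          rw [← h, Finset.mem_filter] at hr
          omega⟩)) U r (by omega) rfl
      have i2 := ih _ (Finset.card_lt_card (Finset.ssubset_iff_subset_ne.2
        ⟨fun k hk => by
          rw [Finset.mem_filter, Finset.mem_erase] at hk
          rw [Finset.mem_filter]
          exact ⟨hk.1.2, hk.2⟩, fun h => by
          rw [← h, Finset.mem_filter] at hr
          simp at hr⟩)) (U.erase r) n hn rfl
      have e1 := h1 U n r hn hrn hrU hU
      have e2 := rowSum_stripState_erase (y := y) (X := y (n + 1)) hrU hrn hU
        (fun k hk => hy k (by omega)) (fun k hk => hyy _ _ (by omega) (by omega))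
        (fun k hk => hyy _ _ (by omega) (by omega))
      rw [i1, i2, ← e2] at e1
      exact add_right_cancel e1

end PathSum

/-! ### Linear extensions and the recursion for the generating function -/

section LinearExtensions

variable {P K : Type*} [Field K]

open Classical in
/-- The bijections from `S` to `{1, …, |S|}` that are increasing along `r`, extended by `0`. -/
def extensions [Fintype P] (r : P → P → Prop) (S : Finset P) : Finset (P → ℕ) :=
  (Fintype.piFinset fun _ => Finset.range (S.card + 1)).filter fun f =>
    (∀ x, x ∉ S → f x = 0) ∧ (∀ x ∈ S, 0 < f x) ∧ (∀ x ∈ S, ∀ y ∈ S, f x = f y → x = y) ∧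
      ∀ x ∈ S, ∀ y ∈ S, r x y → f x < f y

open Classical in
/-- The number of inversions of a linear extension. -/
def inversions (I : P → P → Prop) (S : Finset P) (f : P → ℕ) : ℕ :=
  ∑ x ∈ S, (S.filter fun y => f y < f x ∧ I x y).card

variable [Fintype P] {q : K} {r I : P → P → Prop} {S : Finset P}

lemma mem_extensions {f : P → ℕ} : f ∈ extensions r S ↔ (∀ x, f x ≤ S.card) ∧
    (∀ x, x ∉ S → f x = 0) ∧ (∀ x ∈ S, 0 < f x) ∧ (∀ x ∈ S, ∀ y ∈ S, f x = f y → x = y) ∧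
      ∀ x ∈ S, ∀ y ∈ S, r x y → f x < f y := by
  simp [extensions]

lemma extensions_empty : extensions r (∅ : Finset P) = {fun _ => 0} := by
  ext f
  simp only [mem_extensions, Finset.mem_singleton, funext_iff]
  simp

lemma exists_eq_card {f : P → ℕ} (hf : f ∈ extensions r S) (hS : S.Nonempty) :
    ∃ x ∈ S, f x = S.card := by
  classical
  obtain ⟨h1, -, h3, h4, -⟩ := mem_extensions.1 hf
  -- An injective image of `S` inside an interval with `S.card` elements is the whole interval.
  have hsub : S.image f ⊆ Finset.Icc 1 S.card := by
    intro k hk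
    obtain ⟨x, hx, rfl⟩ := Finset.mem_image.1 hk
    exact Finset.mem_Icc.2 ⟨h3 x hx, h1 x⟩
  have hc : (S.image f).card = S.card := Finset.card_image_of_injOn fun x hx y hy => h4 x hx y hy
  have he := Finset.eq_of_subset_of_card_le hsub (by simp [hc])
  have : S.card ∈ S.image f := by
    rw [he, Finset.mem_Icc]
    exact ⟨hS.card_pos, le_rfl⟩
  simpa using this

open Classical in
lemma update_mem_extensions {x : P} (hx : x ∈ maxElems r S) {g : P → ℕ}
    (hg : g ∈ extensions r (S.erase x)) : Function.update g x S.card ∈ extensions r S := by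
  obtain ⟨hxS, hmax⟩ := mem_maxElems.1 hx
  obtain ⟨h1, h2, h3, h4, h5⟩ := mem_extensions.1 hg
  have hc : (S.erase x).card + 1 = S.card := Finset.card_erase_add_one hxS
  have hlt : ∀ y, g y < S.card := fun y => by have := h1 y; omega
  rw [mem_extensions]
  refine ⟨fun y => ?_, fun y hy => ?_, fun y hy => ?_, fun y hy z hz h => ?_, fun y hy z hz h => ?_⟩
  · by_cases hyx : y = x
    · simp [hyx]
    · simpa [hyx] using (hlt y).le
  · have hyx : y ≠ x := fun h => hy (h ▸ hxS)
    simpa [hyx] using h2 y fun h => hy (Finset.mem_of_mem_erase h)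
  · by_cases hyx : y = x
    · simpa [hyx] using ⟨x, hxS⟩
    · simpa [hyx] using h3 y (Finset.mem_erase.2 ⟨hyx, hy⟩)
  · by_cases hyx : y = x <;> by_cases hzx : z = x
    · rw [hyx, hzx]
    · subst hyx
      have := hlt z
      simp only [Function.update_self, Function.update_of_ne hzx] at h
      omega
    · subst hzx
      have := hlt y
      simp only [Function.update_self, Function.update_of_ne hyx] at h
      omega
    · simp only [Function.update_of_ne hyx, Function.update_of_ne hzx] at h
      exact h4 y (Finset.mem_erase.2 ⟨hyx, hy⟩) z (Finset.mem_erase.2 ⟨hzx, hz⟩) h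
  · have hyx : y ≠ x := fun hyx => hmax z hz (hyx ▸ h)
    by_cases hzx : z = x
    · simpa [hyx, hzx] using hlt y
    · simpa [hyx, hzx] using
        h5 y (Finset.mem_erase.2 ⟨hyx, hy⟩) z (Finset.mem_erase.2 ⟨hzx, hz⟩) h

open Classical in
lemma update_zero_mem_extensions {x : P} (hx : x ∈ S) {f : P → ℕ} (hf : f ∈ extensions r S)
    (hfx : f x = S.card) :
    x ∈ maxElems r S ∧ Function.update f x 0 ∈ extensions r (S.erase x) := by
  obtain ⟨h1, h2, h3, h4, h5⟩ := mem_extensions.1 hf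
  have hc : (S.erase x).card + 1 = S.card := Finset.card_erase_add_one hx
  refine ⟨mem_maxElems.2 ⟨hx, fun y hy hxy => ?_⟩, mem_extensions.2
    ⟨fun y => ?_, fun y hy => ?_, fun y hy => ?_, fun y hy z hz h => ?_, fun y hy z hz h => ?_⟩⟩
  · have := h5 x hx y hy hxy
    have := h1 y
    omega
  · by_cases hyx : y = x
    · simp [hyx]
    · rw [Function.update_of_ne hyx]
      by_cases hyS : y ∈ S
      · have h6 : f y ≠ f x := fun h => hyx (h4 y hyS x hx h)
        have := h1 y
        omega
      · rw [h2 y hyS]; omega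
  · by_cases hyx : y = x
    · simp [hyx]
    · rw [Function.update_of_ne hyx]
      exact h2 y fun h => hy (Finset.mem_erase.2 ⟨hyx, h⟩)
  · rw [Finset.mem_erase] at hy
    rw [Function.update_of_ne hy.1]
    exact h3 y hy.2
  · rw [Finset.mem_erase] at hy hz
    rw [Function.update_of_ne hy.1, Function.update_of_ne hz.1] at h
    exact h4 y hy.2 z hz.2 h
  · rw [Finset.mem_erase] at hy hz
    rw [Function.update_of_ne hy.1, Function.update_of_ne hz.1]
    exact h5 y hy.2 z hz.2 h

-- The new element takes the largest value, so it is preceded by all others and adds one inversion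
-- for each larger label; pairs among the others are unaffected.
open Classical in
lemma inversions_update {x : P} (hx : x ∈ S) {g : P → ℕ} (hg : g ∈ extensions r (S.erase x)) :
    inversions I S (Function.update g x S.card) =
      ((S.erase x).filter (I x)).card + inversions I (S.erase x) g := by
  obtain ⟨h1, -⟩ := mem_extensions.1 hg
  have hc : (S.erase x).card + 1 = S.card := Finset.card_erase_add_one hx
  have hlt : ∀ y, g y < S.card := fun y => by have := h1 y; omega
  rw [inversions, ← Finset.add_sum_erase S _ hx, inversions]
  congr 1
  · congr 1
    ext y
    simp only [Finset.mem_filter, Finset.mem_erase, Function.update_self]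
    by_cases hyx : y = x
    · simp [hyx]
    · simp [hyx, hlt y]
  · refine Finset.sum_congr rfl fun u hu => ?_
    congr 1
    ext y
    simp only [Finset.mem_filter, Finset.mem_erase]
    rw [Function.update_of_ne (Finset.ne_of_mem_erase hu)]
    by_cases hyx : y = x
    · simp [hyx, (hlt u).le]
    · simp [hyx]

/-- This identifies the recursively defined `normSum` with an actual sum over linear extensions. An
extension is the same as its last element, which is maximal, together with an extension of the
remaining set. -/
lemma sum_extensions (hq : ∀ n, 0 < n → 1 - q ^ n ≠ 0) :
    ∑ f ∈ extensions r S, q ^ inversions I S f =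
      normSum q r I S * ∏ i ∈ Finset.Icc 1 S.card, (1 - q ^ i) := by
  classical
  induction hn : S.card generalizing S with
  | zero =>
    rw [Finset.card_eq_zero.1 hn, extensions_empty]
    simp [inversions]
  | succ n ih =>
    have hS : S.Nonempty := Finset.card_pos.1 (by omega)
    rw [Finset.prod_Icc_succ_top (by omega), ← hn, mul_comm (∏ i ∈ _, _), ← mul_assoc,
      mul_comm (normSum q r I S), normSum_rec hq hS, Finset.sum_mul]
    have e1 : ∀ x ∈ maxElems r S, q ^ ((S.erase x).filter (I x)).card *
        normSum q r I (S.erase x) * ∏ i ∈ Finset.Icc 1 n, (1 - q ^ i) =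
        ∑ g ∈ extensions r (S.erase x), q ^ inversions I S (Function.update g x S.card) := by
      intro x hx
      have hxS := (mem_maxElems.1 hx).1
      rw [mul_assoc, ← ih (by rw [Finset.card_erase_of_mem hxS, hn]; rfl), Finset.mul_sum]
      refine Finset.sum_congr rfl fun g hg => ?_
      rw [inversions_update hxS hg, pow_add]
    rw [Finset.sum_congr rfl e1, Finset.sum_sigma']
    symm
    refine Finset.sum_bij (fun p _ => Function.update p.2 p.1 S.card) ?_ ?_ ?_ ?_
    · rintro ⟨x, g⟩ hp
      rw [Finset.mem_sigma] at hp
      exact update_mem_extensions hp.1 hp.2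
    · rintro ⟨x, g⟩ hp ⟨x', g'⟩ hp' h
      rw [Finset.mem_sigma] at hp hp'
      have hc : (S.erase x').card + 1 = S.card :=
        Finset.card_erase_add_one (mem_maxElems.1 hp'.1).1
      simp only at h hp hp'
      -- The removed element is recovered as the one with value `S.card`, which the values of `g'`
      -- cannot reach.
      have hxx : x = x' := by
        by_contra hne
        have h1 := congrFun h x
        rw [Function.update_self, Function.update_of_ne hne] at h1
        have := (mem_extensions.1 hp'.2).1 x
        omega
      subst hxx
      congr 1
      ext y
      by_cases hyx : y = x
      · subst hyx
        rw [(mem_extensions.1 hp.2).2.1 y (by simp), (mem_extensions.1 hp'.2).2.1 y (by simp)]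
      · simpa [hyx] using congrFun h y
    · intro f hf
      obtain ⟨x, hx, hfx⟩ := exists_eq_card hf hS
      obtain ⟨h1, h2⟩ := update_zero_mem_extensions hx hf hfx
      exact ⟨⟨x, Function.update f x 0⟩, Finset.mem_sigma.2 ⟨h1, h2⟩, by simp [← hfx]⟩
    · intro p _
      rfl

lemma one_sub_X_pow_ne_zero (n : ℕ) (hn : 0 < n) : 1 - (RatFunc.X : RatFunc ℚ) ^ n ≠ 0 := by
  intro h
  have h1 : (RatFunc.X : RatFunc ℚ) ^ n = 1 := (sub_eq_zero.1 h).symm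
  rw [← RatFunc.algebraMap_X, ← map_pow, ← map_one (algebraMap (Polynomial ℚ) (RatFunc ℚ))] at h1
  have h2 := congrArg Polynomial.natDegree (RatFunc.algebraMap_injective ℚ h1)
  simp at h2
  omega

lemma inversionCount_eq [PartialOrder P] (ω : P ≃ Fin (Fintype.card P))
    (σ : Equiv.Perm (Fin (Fintype.card P))) :
    inversionCount σ = inversions (fun x y => ω x < ω y) Finset.univ
      (fun x => (σ.symm (ω x) : ℕ) + 1) := by
  classical
  -- The outer sum runs over the later entry of an inversion, which corresponds to the element `x`
  -- in `inversions`. The shift by one makes the positions start from `1`, the value `0` being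
  -- reserved for elements outside the set.
  rw [inversionCount, inversions, Finset.card_filter, ← Finset.univ_product_univ,
    Finset.sum_product_right]
  refine Fintype.sum_equiv (σ.trans ω.symm) _ _ fun i => ?_
  rw [Finset.card_filter]
  refine Fintype.sum_equiv (σ.trans ω.symm) _ _ fun j => ?_
  simp

/-- The inversion generating function in terms of the recursion by the last element. -/
lemma eInv_eq_normSum [PartialOrder P] (ω : P ≃ Fin (Fintype.card P)) :
    eInv ω = normSum (RatFunc.X : RatFunc ℚ) (· < ·) (fun x y => ω x < ω y) Finset.univ *
      ∏ i ∈ Finset.Icc 1 (Fintype.card P), (1 - (RatFunc.X : RatFunc ℚ) ^ i) := by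
  classical
  have h := sum_extensions (S := (Finset.univ : Finset P)) (r := (· < ·))
    (I := fun x y => ω x < ω y) one_sub_X_pow_ne_zero
  rw [Finset.card_univ] at h
  rw [← h, eInv]
  refine Finset.sum_bij (fun σ _ x => (σ.symm (ω x) : ℕ) + 1) ?_ ?_ ?_ ?_
  · intro σ hσ
    obtain ⟨f, hf, rfl⟩ := (Finset.mem_filter.1 hσ).2
    simp only [mem_extensions, Equiv.symm_trans_apply, Equiv.symm_symm, Equiv.symm_apply_apply,
      Finset.card_univ]
    refine ⟨fun x => (f x).2, fun x hx => absurd (Finset.mem_univ x) hx, fun x _ => by omega,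
      fun x _ y _ h => f.injective (Fin.ext (by omega)), fun x _ y _ h => ?_⟩
    have := (hf h.le).lt_of_ne (fun h' => h.ne (f.injective h'))
    exact Nat.succ_lt_succ this
  · intro σ _ τ _ h
    have : σ.symm = τ.symm := by
      ext i
      have := congrFun h (ω.symm i)
      simpa using this
    simpa using congrArg Equiv.symm this
  · intro f hf
    obtain ⟨h1, -, h3, h4, h5⟩ := mem_extensions.1 hf
    have hb : Function.Bijective (fun x : P =>
        (⟨f x - 1, by
          have := h1 x; have := h3 x (Finset.mem_univ x); rw [Finset.card_univ] at *; omega⟩ :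
          Fin (Fintype.card P))) := by
      rw [Fintype.bijective_iff_injective_and_card]
      refine ⟨fun x y h => h4 x (Finset.mem_univ x) y (Finset.mem_univ y) ?_, by simp⟩
      have := h3 x (Finset.mem_univ x)
      have := h3 y (Finset.mem_univ y)
      simp only [Fin.mk.injEq] at h
      omega
    refine ⟨(Equiv.ofBijective _ hb).symm.trans ω, ?_, ?_⟩
    · refine Finset.mem_filter.2 ⟨Finset.mem_univ _, _, fun x y hxy => ?_, rfl⟩
      rcases hxy.eq_or_lt with rfl | hxy
      · exact le_rfl
      · have := h5 x (Finset.mem_univ x) y (Finset.mem_univ y) hxy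
        simp only [Equiv.ofBijective_apply, Fin.mk_le_mk]
        omega
    · ext x
      have := h3 x (Finset.mem_univ x)
      simp only [Equiv.symm_trans_apply, Equiv.symm_symm, Equiv.symm_apply_apply,
        Equiv.ofBijective_apply]
      omega
  · intro σ _
    rw [inversionCount_eq ω]

end LinearExtensions

/-! ### The geometry of border strips -/

section Geometry

variable {lam mu : YoungDiagram}

/-- The content of a cell. -/
def content (c : ℕ × ℕ) : ℤ := (c.2 : ℤ) - c.1

lemma mem_skewCells {c : ℕ × ℕ} : c ∈ skewCells lam mu ↔ c ∈ lam ∧ c ∉ mu := by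
  simp [skewCells]

lemma mem_skewCells_of_le {c d e : ℕ × ℕ} (hc : c ∈ skewCells lam mu) (he : e ∈ skewCells lam mu)
    (h1 : c ≤ d) (h2 : d ≤ e) : d ∈ skewCells lam mu := by
  rw [mem_skewCells] at *
  exact ⟨lam.up_left_mem h2.1 h2.2 he.1, fun h => hc.2 (mu.up_left_mem h1.1 h1.2 h)⟩

namespace IsBorderStrip

lemma eq_of_content_eq (h : IsBorderStrip lam mu)
    {c d : ℕ × ℕ} (hc : c ∈ skewCells lam mu) (hd : d ∈ skewCells lam mu)
    (hcd : content c = content d) : c = d := by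
  obtain ⟨i, j⟩ := c
  obtain ⟨i', j'⟩ := d
  simp only [content] at hcd
  rcases lt_trichotomy i i' with hlt | rfl | hlt
  · have e1 : i + (i' - i - 1) + 1 = i' := by omega
    have e2 : j + (i' - i - 1) + 1 = j' := by omega
    exact (h.diagonal i j (i' - i - 1) hc (by rw [e1, e2]; exact hd)).elim
  · have : j = j' := by omega
    rw [this]
  · have e1 : i' + (i - i' - 1) + 1 = i := by omega
    have e2 : j' + (i - i' - 1) + 1 = j := by omega
    exact (h.diagonal i' j' (i - i' - 1) hd (by rw [e1, e2]; exact hc)).elim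

/-- Were one of the inequalities to fail, a cell between `c` and `d` in the product order, hence in
the strip, would share a diagonal with one of them and yet differ from it. -/
lemma of_content_lt (h : IsBorderStrip lam mu)
    {c d : ℕ × ℕ} (hc : c ∈ skewCells lam mu) (hd : d ∈ skewCells lam mu)
    (hcd : content c < content d) : d.1 ≤ c.1 ∧ c.2 ≤ d.2 := by
  obtain ⟨i, j⟩ := c
  obtain ⟨i', j'⟩ := d
  simp only [content] at hcd ⊢
  constructor
  · by_contra hcon
    have h1 : (i', j + (i' - i)) ∈ skewCells lam mu :=
      mem_skewCells_of_le hc hd ⟨by simp; omega, by simp⟩ ⟨le_rfl, by simp; omega⟩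
    have h2 := h.eq_of_content_eq hc h1 (by simp only [content]; omega)
    simp only [Prod.mk.injEq] at h2
    omega
  · by_contra hcon
    have h1 : (i' + (j - j'), j) ∈ skewCells lam mu :=
      mem_skewCells_of_le hd hc ⟨by simp, by simp; omega⟩ ⟨by simp; omega, le_rfl⟩
    have h2 := h.eq_of_content_eq hd h1 (by simp only [content]; omega)
    simp only [Prod.mk.injEq] at h2
    omega

lemma of_content_le (h : IsBorderStrip lam mu)
    {c d : ℕ × ℕ} (hc : c ∈ skewCells lam mu) (hd : d ∈ skewCells lam mu)
    (hcd : content c ≤ content d) : d.1 ≤ c.1 ∧ c.2 ≤ d.2 := by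
  rcases hcd.lt_or_eq with h1 | h1
  · exact h.of_content_lt hc hd h1
  · rw [h.eq_of_content_eq hc hd h1]
    exact ⟨le_rfl, le_rfl⟩

/-- Two consecutive cells of a border strip. -/
lemma of_content_eq_add_one (h : IsBorderStrip lam mu)
    {c d : ℕ × ℕ} (hc : c ∈ skewCells lam mu) (hd : d ∈ skewCells lam mu)
    (hcd : content d = content c + 1) : d = (c.1, c.2 + 1) ∨ c = (d.1 + 1, d.2) := by
  have := h.of_content_lt hc hd (by omega)
  simp only [content] at hcd
  rcases Nat.eq_or_lt_of_le this.1 with h1 | h1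
  · exact Or.inl (Prod.ext h1 (by simp; omega))
  · exact Or.inr (Prod.ext (by simp; omega) (by simp; omega))

/-- The contents of a border strip form an interval. -/
lemma exists_content_eq (h : IsBorderStrip lam mu)
    {c d : ℕ × ℕ} (hc : c ∈ skewCells lam mu) (hd : d ∈ skewCells lam mu)
    {k : ℤ} (h1 : content c ≤ k) (h2 : k ≤ content d) :
    ∃ e ∈ skewCells lam mu, content e = k := by
  obtain ⟨w⟩ := h.connected.preconnected ⟨c, hc⟩ ⟨d, hd⟩
  have key : ∀ a b : (skewCells lam mu : Set (ℕ × ℕ)),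
      ((SimpleGraph.hasse (ℕ × ℕ)).induce (skewCells lam mu : Set (ℕ × ℕ))).Walk a b →
      content a.1 ≤ k → k ≤ content b.1 → ∃ e ∈ skewCells lam mu, content e = k := by
    intro a b w
    induction w with
    | nil => exact fun h1 h2 => ⟨_, Subtype.property _, le_antisymm h1 h2⟩
    | @cons u v w' hadj p ih =>
      intro h1 h2
      rcases h1.eq_or_lt with h3 | h3
      · exact ⟨_, u.2, h3⟩
      -- Adjacent cells have contents differing by one, so the walk cannot jump over the value `k`.
      · refine ih ?_ h2
        have h4 : (SimpleGraph.hasse (ℕ × ℕ)).Adj u.1 v.1 := hadj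
        rw [SimpleGraph.hasse_adj, ← Prod.mk.eta (p := u.1), ← Prod.mk.eta (p := v.1),
          Prod.mk_covBy_mk_iff, Prod.mk_covBy_mk_iff, Nat.covBy_iff_add_one_eq,
          Nat.covBy_iff_add_one_eq, Nat.covBy_iff_add_one_eq, Nat.covBy_iff_add_one_eq] at h4
        simp only [content] at h3 ⊢
        omega
  exact key _ _ w h1 h2

/-- The strip lies in the rim of λ. In particular, two cells of the strip in a column leave no room
in λ to the right of the lower one. -/
lemma not_mem_of_mem_skewCells (h : IsBorderStrip lam mu) {i j : ℕ} (hc : (i, j) ∈ skewCells lam mu) :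
    (i + 1, j + 1) ∉ lam := fun hl =>
  h.diagonal i j 0 hc (mem_skewCells.2 ⟨hl, fun hm =>
    (mem_skewCells.1 hc).2 (mu.up_left_mem (by omega) (by omega) hm)⟩)

end IsBorderStrip

/-- The border strip `λ/μ` has `n + 1` cells, leading from the cell `s` at the bottom left to the
cell `t` at the top right. -/
structure StripEnds (lam mu : YoungDiagram) (s t : ℕ × ℕ) (n : ℕ) : Prop where
  strip : IsBorderStrip lam mu
  start_mem : s ∈ skewCells lam mu
  end_mem : t ∈ skewCells lam mu
  content_end : content t = content s + n
  start_le : ∀ c ∈ skewCells lam mu, content s ≤ content c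
  le_end : ∀ c ∈ skewCells lam mu, content c ≤ content t

lemma IsBorderStrip.exists_stripEnds (h : IsBorderStrip lam mu) :
    ∃ s t n, StripEnds lam mu s t n := by
  obtain ⟨⟨c, hc⟩⟩ := h.connected.nonempty
  have hne : (skewCells lam mu).Nonempty := ⟨c, hc⟩
  obtain ⟨s, hs, hs'⟩ := (skewCells lam mu).exists_min_image content hne
  obtain ⟨t, ht, ht'⟩ := (skewCells lam mu).exists_max_image content hne
  refine ⟨s, t, (content t - content s).toNat, h, hs, ht, ?_, hs', ht'⟩
  have := hs' t ht
  omega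

/-- The position of a cell of a strip that starts at `s`. -/
def idx (s c : ℕ × ℕ) : ℕ := (content c - content s).toNat

namespace StripEnds

variable {s t : ℕ × ℕ} {n : ℕ}

lemma content_eq (E : StripEnds lam mu s t n) {c : ℕ × ℕ} (hc : c ∈ skewCells lam mu) :
    content c = content s + idx s c := by
  have := E.start_le c hc
  rw [idx]
  omega

lemma idx_le (E : StripEnds lam mu s t n)
    {c : ℕ × ℕ} (hc : c ∈ skewCells lam mu) : idx s c ≤ n := by
  have := E.content_eq hc
  have := E.le_end c hc
  have := E.content_end
  omega

lemma idx_inj (E : StripEnds lam mu s t n)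
    {c d : ℕ × ℕ} (hc : c ∈ skewCells lam mu) (hd : d ∈ skewCells lam mu)
    (h : idx s c = idx s d) : c = d :=
  E.strip.eq_of_content_eq hc hd (by rw [E.content_eq hc, E.content_eq hd, h])

lemma exists_idx_eq (E : StripEnds lam mu s t n)
    {k : ℕ} (hk : k ≤ n) : ∃ c ∈ skewCells lam mu, idx s c = k := by
  obtain ⟨c, hc, e⟩ := E.strip.exists_content_eq E.start_mem E.end_mem
    (k := content s + k) (by omega) (by rw [E.content_end]; omega)
  exact ⟨c, hc, by rw [idx]; omega⟩

lemma of_idx_lt (E : StripEnds lam mu s t n)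
    {c d : ℕ × ℕ} (hc : c ∈ skewCells lam mu) (hd : d ∈ skewCells lam mu)
    (h : idx s c < idx s d) : d.1 ≤ c.1 ∧ c.2 ≤ d.2 :=
  E.strip.of_content_lt hc hd (by rw [E.content_eq hc, E.content_eq hd]; omega)

lemma idx_lt_of_col_lt (E : StripEnds lam mu s t n)
    {c d : ℕ × ℕ} (hc : c ∈ skewCells lam mu) (hd : d ∈ skewCells lam mu)
    (h : c.2 < d.2) : idx s c < idx s d := by
  by_contra hcon
  rcases (not_lt.1 hcon).lt_or_eq with h1 | h1
  · have := E.of_idx_lt hd hc h1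
    omega
  · rw [E.idx_inj hd hc h1] at h
    omega

lemma idx_lt_iff_of_col_eq (E : StripEnds lam mu s t n) {c d : ℕ × ℕ} (hc : c ∈ skewCells lam mu)
    (hd : d ∈ skewCells lam mu) (h : c.2 = d.2) : idx s c < idx s d ↔ d.1 < c.1 := by
  have h1 := E.content_eq hc
  have h2 := E.content_eq hd
  simp only [content] at h1 h2
  omega

lemma of_idx_eq_add_one (E : StripEnds lam mu s t n)
    {c d : ℕ × ℕ} (hc : c ∈ skewCells lam mu) (hd : d ∈ skewCells lam mu)
    (h : idx s d = idx s c + 1) : d = (c.1, c.2 + 1) ∨ c = (d.1 + 1, d.2) :=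
  E.strip.of_content_eq_add_one hc hd (by
    rw [E.content_eq hc, E.content_eq hd, h]; push_cast; ring)

lemma idx_right (E : StripEnds lam mu s t n)
    {i j : ℕ} (h1 : (i, j) ∈ skewCells lam mu) (h2 : (i, j + 1) ∈ skewCells lam mu) :
    idx s (i, j + 1) = idx s (i, j) + 1 := by
  have := E.content_eq h1
  have := E.content_eq h2
  simp only [content] at *
  omega

lemma idx_up (E : StripEnds lam mu s t n)
    {i j : ℕ} (h1 : (i + 1, j) ∈ skewCells lam mu) (h2 : (i, j) ∈ skewCells lam mu) :
    idx s (i, j) = idx s (i + 1, j) + 1 := by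
  have := E.content_eq h1
  have := E.content_eq h2
  simp only [content] at *
  omega

end StripEnds

open Classical in
/-- The upward steps of a border strip that starts at `s`. -/
def upSteps (lam mu : YoungDiagram) (s : ℕ × ℕ) : Finset ℕ :=
  ((skewCells lam mu).filter fun c => 1 ≤ c.1 ∧ (c.1 - 1, c.2) ∈ skewCells lam mu).image (idx s)

lemma StripEnds.idx_mem_upSteps {s t : ℕ × ℕ} {n : ℕ} (E : StripEnds lam mu s t n) {c : ℕ × ℕ}
    (hc : c ∈ skewCells lam mu) :
    idx s c ∈ upSteps lam mu s ↔ 1 ≤ c.1 ∧ (c.1 - 1, c.2) ∈ skewCells lam mu := by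
  simp only [upSteps, Finset.mem_image, Finset.mem_filter]
  constructor
  · rintro ⟨d, ⟨h1, h2⟩, h3⟩
    rwa [← E.idx_inj h1 hc h3]
  · exact fun h => ⟨c, ⟨hc, h⟩, rfl⟩

end Geometry

/-! ### The generating function of a mobile tree poset -/

section MobileSum

variable {lam mu : YoungDiagram} {V : Type*} [PartialOrder V] {T : HangingTrees lam mu V}

/-- The cell of the strip to which an element of the mobile tree poset belongs. -/
def Mobile.cell : Mobile T → ℕ × ℕ
  | Sum.inl c => c.1
  | Sum.inr v => T.cell v

@[elab_as_elim]
lemma Mobile.ind {p : Mobile T → Prop} (strip : ∀ c, p (Mobile.strip T c))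
    (tree : ∀ v, p (Mobile.tree T v)) (x : Mobile T) : p x := by
  rcases x with c | v
  · exact strip c
  · exact tree v

@[simp] lemma Mobile.cell_strip (c : {c : ℕ × ℕ // c ∈ skewCells lam mu}) :
    (Mobile.strip T c).cell = c.1 := rfl

@[simp] lemma Mobile.cell_tree (v : V) : (Mobile.tree T v).cell = T.cell v := rfl

@[simp] lemma Mobile.tree_ne_strip (v : V) (c : {c : ℕ × ℕ // c ∈ skewCells lam mu}) :
    Mobile.tree T v ≠ Mobile.strip T c := Sum.inr_ne_inl

lemma Mobile.strip_eq_strip {s t : ℕ × ℕ} {n : ℕ} (E : StripEnds lam mu s t n)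
    {c d : {c : ℕ × ℕ // c ∈ skewCells lam mu}} :
    Mobile.strip T c = Mobile.strip T d ↔ idx s c.1 = idx s d.1 :=
  ⟨fun h => by rw [Sum.inl_injective h], fun h => congrArg _ (Subtype.ext (E.idx_inj c.2 d.2 h))⟩

lemma Mobile.cell_mem (x : Mobile T) : x.cell ∈ skewCells lam mu := by
  rcases x with c | v
  · exact c.2
  · exact T.cell_mem v

lemma Mobile.tree_injective : Function.Injective (Mobile.tree T) := fun _ _ h => Sum.inr_injective h

lemma Mobile.tree_le_tree {v w : V} : Mobile.tree T v ≤ Mobile.tree T w ↔ v ≤ w := Iff.rfl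

lemma Mobile.tree_lt_tree {v w : V} : Mobile.tree T v < Mobile.tree T w ↔ v < w := by
  rw [lt_iff_le_not_ge, lt_iff_le_not_ge, Mobile.tree_le_tree, Mobile.tree_le_tree]

/-- A relation on the mobile tree poset whose steps along the strip, which starts at `s`, are
upward at the positions in `U`, downward at the positions in `R`, and absent elsewhere. -/
def stepRel (T : HangingTrees lam mu V) (s : ℕ × ℕ) (U R : Set ℕ) : Mobile T → Mobile T → Prop
  | Sum.inl c, Sum.inl d => (idx s d.1 = idx s c.1 + 1 ∧ idx s c.1 ∈ U) ∨
      (idx s c.1 = idx s d.1 + 1 ∧ idx s d.1 ∈ R)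
  | Sum.inr v, Sum.inl c => T.cell v = c.1
  | Sum.inr v, Sum.inr w => v < w
  | Sum.inl _, Sum.inr _ => False

section

variable {s : ℕ × ℕ} {U R : Set ℕ} {c d : {c : ℕ × ℕ // c ∈ skewCells lam mu}} {v w : V}

@[simp] lemma stepRel_strip_strip : stepRel T s U R (Mobile.strip T c) (Mobile.strip T d) ↔
    (idx s d.1 = idx s c.1 + 1 ∧ idx s c.1 ∈ U) ∨
      (idx s c.1 = idx s d.1 + 1 ∧ idx s d.1 ∈ R) := Iff.rfl

@[simp] lemma stepRel_tree_strip : stepRel T s U R (Mobile.tree T v) (Mobile.strip T c) ↔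
    T.cell v = c.1 := Iff.rfl

@[simp] lemma stepRel_tree_tree : stepRel T s U R (Mobile.tree T v) (Mobile.tree T w) ↔
    v < w := Iff.rfl

@[simp] lemma not_stepRel_strip_tree : ¬ stepRel T s U R (Mobile.strip T c) (Mobile.tree T v) := id

end

/-- The order of labels in which the cells, together with their trees, are labeled from the top
right to the bottom left. -/
def BlockLt {N : ℕ} (s : ℕ × ℕ) (ω : Mobile T ≃ Fin N) (x y : Mobile T) : Prop :=
  idx s y.cell < idx s x.cell ∨ (idx s x.cell = idx s y.cell ∧ ω x < ω y)

lemma stepRel_cell {s : ℕ × ℕ} {U R : Set ℕ} {x y : Mobile T} (h : stepRel T s U R x y) :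
    idx s x.cell = idx s y.cell ∨ (idx s y.cell = idx s x.cell + 1 ∧ idx s x.cell ∈ U) ∨
      (idx s x.cell = idx s y.cell + 1 ∧ idx s y.cell ∈ R) := by
  rcases x with c | v <;> rcases y with d | w
  · exact Or.inr h
  · exact h.elim
  · exact Or.inl (congrArg _ h)
  · exact Or.inl (congrArg _ (T.cell_eq v w (le_of_lt h)))

lemma stepRel_congr {s : ℕ × ℕ} {U R U' R' : Set ℕ} {x y : Mobile T}
    (hU : idx s y.cell = idx s x.cell + 1 → (idx s x.cell ∈ U ↔ idx s x.cell ∈ U'))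
    (hR : idx s x.cell = idx s y.cell + 1 → (idx s y.cell ∈ R ↔ idx s y.cell ∈ R')) :
    stepRel T s U R x y ↔ stepRel T s U' R' x y := by
  rcases x with c | v <;> rcases y with d | w
  · exact or_congr (and_congr_right hU) (and_congr_right hR)
  all_goals exact Iff.rfl

section Fintype

variable [Fintype V]

open Classical in
/-- The elements of the mobile tree poset that belong to the positions from `a` to `b`. -/
def block (T : HangingTrees lam mu V) (s : ℕ × ℕ) (a b : ℕ) : Finset (Mobile T) :=
  Finset.univ.filter fun x => a ≤ idx s x.cell ∧ idx s x.cell ≤ b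

lemma mem_block {s : ℕ × ℕ} {a b : ℕ} {x : Mobile T} :
    x ∈ block T s a b ↔ a ≤ idx s x.cell ∧ idx s x.cell ≤ b := by
  simp [block]

open Classical in
/-- The vertices of the trees that hang on the cell at position `a`. -/
def treesAt (T : HangingTrees lam mu V) (s : ℕ × ℕ) (a : ℕ) : Finset V :=
  Finset.univ.filter fun v => idx s (T.cell v) = a

lemma mem_treesAt {s : ℕ × ℕ} {a : ℕ} {v : V} : v ∈ treesAt T s a ↔ idx s (T.cell v) = a := by
  simp [treesAt]

/-- The contribution of the trees that hang on the cell at position `a`. -/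
def treeFactor {K : Type*} [Field K] (q : K) (T : HangingTrees lam mu V) (s : ℕ × ℕ) (a : ℕ) : K :=
  ∏ v ∈ treesAt T s a, 1 / (1 - q ^ treeHook v)

open Classical in
/-- The number of elements that belong to the positions before `a`. -/
def sizeBefore (T : HangingTrees lam mu V) (s : ℕ × ℕ) (a : ℕ) : ℕ :=
  (Finset.univ.filter fun x : Mobile T => idx s x.cell < a).card

lemma sizeBefore_add_card_block {s : ℕ × ℕ} {a b : ℕ} (h : a ≤ b) :
    sizeBefore T s a + (block T s a b).card = sizeBefore T s (b + 1) := by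
  classical
  rw [sizeBefore, sizeBefore, ← Finset.card_union_of_disjoint]
  · congr 1
    ext x
    simp only [Finset.mem_union, Finset.mem_filter, Finset.mem_univ, true_and, mem_block]
    omega
  · rw [Finset.disjoint_left]
    intro x hx hx'
    rw [mem_block] at hx'
    have := (Finset.mem_filter.1 hx).2
    omega

variable {s t : ℕ × ℕ} {n : ℕ} {ω : Mobile T ≃ Fin (Fintype.card (Mobile T))}
  {K : Type*} [Field K] {q : K}

/-- On the trees of a single cell, `stepRel` is the tree order and `BlockLt` compares the labels
`ω`, so the forest hook formula applies. The hooks are those of the whole forest because everything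
below a vertex hangs on the same cell. -/
lemma normSum_trees (hω : IsInvLabeling T ω) (hq : ∀ n, 0 < n → 1 - q ^ n ≠ 0) (U R : Set ℕ)
    (a : ℕ) : normSum q (stepRel T s U R) (BlockLt s ω)
      ((treesAt T s a).map ⟨Mobile.tree T, Mobile.tree_injective⟩) = treeFactor q T s a := by
  classical
  rw [normSum_congr hq (r' := (· < ·)) (I' := fun x y => (ω x : ℕ) < ω y), normSum_forest hq,
    Finset.prod_map, treeFactor]
  · refine Finset.prod_congr rfl fun v hv => ?_
    rw [Finset.filter_map, Finset.card_map, treeHook]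
    congr 4
    ext w
    simp only [Finset.mem_filter, Finset.mem_univ, true_and, mem_treesAt, Function.comp,
      Function.Embedding.coeFn_mk, Mobile.tree_le_tree]
    refine ⟨fun h => h.2, fun h => ⟨?_, h⟩⟩
    rw [T.cell_eq w v h, ← mem_treesAt]
    exact hv
  all_goals simp only [Finset.forall_mem_map, Function.Embedding.coeFn_mk, Mobile.tree_le_tree,
    Mobile.tree_lt_tree]
  · exact fun v _ a _ b _ => T.chain v a b
  · exact fun v _ w _ => hω.natural v w
  · intro v _ x _ y _ z _ hx hy hz hz'
    exact hω.consecutive v _ _ _ hx hy hz hz'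
  · exact fun v _ w _ => Iff.rfl
  · intro v hv w hw
    rw [mem_treesAt] at hv hw
    simp only [BlockLt, Mobile.tree, Mobile.cell, hv, hw]
    simp

-- With only steps to the right, the cell at position `a` is the maximum of the block and has its
-- largest label. Its removal leaves its trees and the block from `a + 1`, which are unrelated, and
-- the trees have the larger labels.
open Classical in
lemma normSum_block_eq_mul (E : StripEnds lam mu s t n) (hω : IsInvLabeling T ω)
    (hq : ∀ n, 0 < n → 1 - q ^ n ≠ 0) {U R : Set ℕ} {a b : ℕ} (hab : a ≤ b) (hb : b ≤ n)
    (hU : ∀ k, a ≤ k → k < b → k ∉ U) (hR : ∀ k, a ≤ k → k < b → k ∈ R) :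
    normSum q (stepRel T s U R) (BlockLt s ω) (block T s a b) =
      1 / (1 - q ^ (block T s a b).card) * treeFactor q T s a *
        normSum q (stepRel T s U R) (BlockLt s ω) (block T s (a + 1) b) := by
  obtain ⟨c, hc, hca⟩ := E.exists_idx_eq (hab.trans hb)
  have hx : Mobile.strip T ⟨c, hc⟩ ∈ block T s a b :=
    mem_block.2 ⟨hca.ge, hca.trans_le hab⟩
  rw [normSum_of_top hq hx]
  · have e : (block T s a b).erase (Mobile.strip T ⟨c, hc⟩) = block T s (a + 1) b ∪
        (treesAt T s a).map ⟨Mobile.tree T, Mobile.tree_injective⟩ := by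
      ext y
      simp only [Finset.mem_erase, Finset.mem_union, mem_block, Finset.mem_map, mem_treesAt,
        Function.Embedding.coeFn_mk]
      induction y using Mobile.ind with
      | strip d =>
        simp only [ne_eq, Mobile.strip_eq_strip E, hca, Mobile.cell_strip, Mobile.tree_ne_strip,
          and_false, exists_false, or_false]
        omega
      | tree v =>
        simp only [ne_eq, Mobile.tree_ne_strip, not_false_eq_true, true_and, Mobile.cell_tree,
          Mobile.tree_injective.eq_iff, exists_eq_right]
        omega
    rw [e, normSum_union hq, normSum_trees hω hq]
    · ring
    · intro x hx y hy
      obtain ⟨v, hv, rfl⟩ := Finset.mem_map.1 hy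
      have hv' : idx s (T.cell v) = a := mem_treesAt.1 hv
      have hx' := (mem_block.1 hx).1
      induction x using Mobile.ind with
      | strip d =>
        refine ⟨id, fun h => ?_⟩
        have h' : T.cell v = d.1 := h
        rw [h'] at hv'
        simp only [Mobile.cell_strip] at hx'
        omega
      | tree w =>
        simp only [Mobile.cell_tree] at hx'
        refine ⟨fun h => ?_, fun h => ?_⟩
        · have := T.cell_eq w v (le_of_lt h)
          rw [this] at hx'
          omega
        · have := T.cell_eq v w (le_of_lt h)
          rw [this] at hv'
          omega
    · intro x hx y hy
      obtain ⟨v, hv, rfl⟩ := Finset.mem_map.1 hy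
      have hv' : idx s (Mobile.tree T v).cell = a := mem_treesAt.1 hv
      have hx' := (mem_block.1 hx).1
      simp only [BlockLt, Function.Embedding.coeFn_mk, hv']
      exact ⟨Or.inl (by omega), by omega⟩
    · rw [Finset.disjoint_left]
      intro x hx hy
      obtain ⟨v, hv, rfl⟩ := Finset.mem_map.1 hy
      have hv' : idx s (Mobile.tree T v).cell = a := mem_treesAt.1 hv
      have hx' := (mem_block.1 hx).1
      simp only [Function.Embedding.coeFn_mk] at hx'
      omega
  · intro y hy
    have hy' := mem_block.1 hy
    constructor
    · intro h
      induction y using Mobile.ind with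
      | strip d =>
        simp only [Mobile.cell_strip] at hy'
        rcases hy'.1.eq_or_lt with h1 | h1
        · exact (Mobile.strip_eq_strip E).2 (h1.symm.trans hca.symm)
        -- A cell after position `a` is covered by its predecessor in the strip, so it is not
        -- maximal.
        · obtain ⟨d', hd', e⟩ := E.exists_idx_eq (k := idx s d.1 - 1) (by omega)
          refine (h (Mobile.strip T ⟨d', hd'⟩) (mem_block.2 ?_) (Or.inr ⟨?_, ?_⟩)).elim
          · simp only [Mobile.cell_strip]
            omega
          · simp only
            omega
          · simp only
            rw [e]
            exact hR _ (by omega) (by omega)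
      | tree v => exact (h (Mobile.strip T ⟨T.cell v, T.cell_mem v⟩) (mem_block.2 hy') rfl).elim
    · rintro rfl z hz hr
      have hz' := mem_block.1 hz
      induction z using Mobile.ind with
      | strip d =>
        simp only [Mobile.cell_strip] at hz'
        rcases hr with ⟨h1, h2⟩ | ⟨h1, h2⟩
        · simp only at h1 h2
          rw [hca] at h1 h2
          exact hU a le_rfl (by omega) h2
        · simp only at h1
          omega
      | tree v => exact hr.elim
  · rintro y hy (h | ⟨h1, h2⟩)
    · have hy' := (mem_block.1 hy).1
      simp only [Mobile.cell_strip] at h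
      omega
    · induction y using Mobile.ind with
      | strip d =>
        have : c = d.1 := E.idx_inj hc d.2 h1
        have h3 : (⟨c, hc⟩ : {c // c ∈ skewCells lam mu}) = d := Subtype.ext this
        rw [h3] at h2
        exact lt_irrefl _ h2
      | tree v =>
        have : c = T.cell v := E.idx_inj hc (T.cell_mem v) h1
        exact lt_asymm h2 ((hω.column ⟨c, hc⟩ v).2 (by simp [this]))

/-- The generating function of a part of the strip without upward steps. -/
lemma normSum_block_of_right (E : StripEnds lam mu s t n) (hω : IsInvLabeling T ω)
    (hq : ∀ n, 0 < n → 1 - q ^ n ≠ 0) {U R : Set ℕ} {a b : ℕ} (hab : a ≤ b + 1) (hb : b ≤ n)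
    (hU : ∀ k, a ≤ k → k < b → k ∉ U) (hR : ∀ k, a ≤ k → k < b → k ∈ R) :
    normSum q (stepRel T s U R) (BlockLt s ω) (block T s a b) =
      ∏ k ∈ Finset.Ico a (b + 1), 1 / (1 - q ^ (block T s k b).card) * treeFactor q T s k := by
  induction hab using Nat.decreasingInduction with
  | self =>
    have : block T s (b + 1) b = ∅ := by
      ext x
      rw [mem_block]
      simp
    simp [this]
  | of_succ a ha ih =>
    rw [normSum_block_eq_mul E hω hq (by omega) hb hU hR,
      ih (fun k hk => hU k (by omega)) (fun k hk => hR k (by omega)),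
      Finset.prod_eq_prod_Ico_succ_bot (show a < b + 1 by omega)]

/-- Splitting the linear extensions at a step of the strip. -/
lemma normSum_block_split (E : StripEnds lam mu s t n)
    (hq : ∀ n, 0 < n → 1 - q ^ n ≠ 0) {U : Finset ℕ} {r b : ℕ} (hr : r < b) (hb : b ≤ n)
    (hU : r ∈ U) :
    normSum q (stepRel T s U (U : Set ℕ)ᶜ) (BlockLt s ω) (block T s 0 b) +
        normSum q (stepRel T s (U.erase r) ((U.erase r : Finset ℕ) : Set ℕ)ᶜ) (BlockLt s ω)
          (block T s 0 b) =
      normSum q (stepRel T s U (U : Set ℕ)ᶜ) (BlockLt s ω) (block T s 0 r) *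
        normSum q (stepRel T s (U.erase r) (U : Set ℕ)ᶜ) (BlockLt s ω) (block T s (r + 1) b) := by
  classical
  obtain ⟨c, hc, hcr⟩ := E.exists_idx_eq (k := r) (by omega)
  obtain ⟨d, hd, hdr⟩ := E.exists_idx_eq (k := r + 1) (by omega)
  -- Here `r` belongs neither to the upward nor to the downward steps, so the strip is cut between
  -- its cells at `r` and `r + 1`. The two ways to order these cells restore the two relations on
  -- the left.
  rw [← normSum_split (r := stepRel T s (U.erase r) (U : Set ℕ)ᶜ) hq
    (a := Mobile.strip T ⟨c, hc⟩) (b := Mobile.strip T ⟨d, hd⟩)]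
  · have e : block T s 0 b = block T s (r + 1) b ∪ block T s 0 r := by
      ext x
      simp only [Finset.mem_union, mem_block]
      omega
    rw [e, normSum_union hq, mul_comm]
    · congr 1
      refine normSum_congr hq (fun x hx y hy => stepRel_congr (fun h => ?_) fun h => Iff.rfl)
        fun _ _ _ _ => Iff.rfl
      rw [mem_block] at hx hy
      have : idx s x.cell ≠ r := by omega
      simp [this]
    · intro x hx y hy
      rw [mem_block] at hx hy
      refine ⟨fun h => ?_, fun h => ?_⟩
      · rcases stepRel_cell h with h | ⟨h, h'⟩ | ⟨h, h'⟩
        · omega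
        · omega
        · have : idx s y.cell = r := by omega
          rw [this] at h'
          exact h' hU
      · rcases stepRel_cell h with h | ⟨h, h'⟩ | ⟨h, h'⟩
        · omega
        · have : idx s y.cell = r := by omega
          rw [this] at h'
          simp at h'
        · omega
    · intro x hx y hy
      rw [mem_block] at hx hy
      exact ⟨Or.inl (by omega), fun h => by
        rcases h with h | h <;> omega⟩
    · rw [Finset.disjoint_left]
      intro x hx hy
      rw [mem_block] at hx hy
      omega
  · intro h
    have : c = d := congrArg Mobile.cell h
    rw [this] at hcr
    omega
  · intro x y
    induction x using Mobile.ind <;> induction y using Mobile.ind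
    · rename_i x y
      simp only [stepRel_strip_strip, Mobile.strip_eq_strip E, hcr, hdr, Finset.coe_erase,
        Set.mem_sdiff, Set.mem_singleton_iff]
      by_cases hx : idx s x.1 = r
      · simp [hx, hU]
        tauto
      · simp [hx]
    all_goals simp
  · intro x y
    induction x using Mobile.ind <;> induction y using Mobile.ind
    · rename_i x y
      simp only [stepRel_strip_strip, Mobile.strip_eq_strip E, hcr, hdr, Finset.coe_erase,
        Set.mem_sdiff, Set.mem_singleton_iff, Set.mem_compl_iff]
      by_cases hy : idx s y.1 = r
      · simp [hy, hU]
      · simp [hy]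
    all_goals simp
  · exact mem_block.2 ⟨Nat.zero_le _, by change idx s c ≤ b; omega⟩
  · exact mem_block.2 ⟨Nat.zero_le _, by change idx s d ≤ b; omega⟩

lemma treeFactor_ne_zero (hq : ∀ n, 0 < n → 1 - q ^ n ≠ 0) (a : ℕ) : treeFactor q T s a ≠ 0 := by
  classical
  refine Finset.prod_ne_zero_iff.2 fun v _ => one_div_ne_zero (hq _ ?_)
  exact Finset.card_pos.2 ⟨v, by simp⟩

lemma card_block_pos (E : StripEnds lam mu s t n) {a b : ℕ} (hab : a ≤ b) (hb : b ≤ n) :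
    0 < (block T s a b).card := by
  obtain ⟨c, hc, e⟩ := E.exists_idx_eq hb
  exact Finset.card_pos.2 ⟨Mobile.strip T ⟨c, hc⟩, mem_block.2 ⟨by change a ≤ idx s c; omega, e.le⟩⟩

/-- The generating function of the strip with the block labeling as a path sum. -/
lemma normSum_block_eq (E : StripEnds lam mu s t n) (hω : IsInvLabeling T ω)
    (hq0 : q ≠ 0) (hq : ∀ n, 0 < n → 1 - q ^ n ≠ 0) (U : Finset ℕ) :
    normSum q (stepRel T s U (U : Set ℕ)ᶜ) (BlockLt s ω) (block T s 0 n) =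
      (∏ k ∈ Finset.range (n + 1), treeFactor q T s k) *
        rowSum (q ^ sizeBefore T s (n + 1))
          (stripState (fun k => q ^ sizeBefore T s k) U n) := by
  -- The factors of the recursion become quotients of the parameters q^(`sizeBefore`), as in the
  -- path sum.
  have hdiv : ∀ k b, k ≤ b →
      q ^ (block T s k b).card = q ^ sizeBefore T s (b + 1) / q ^ sizeBefore T s k := by
    intro k b hkb
    rw [← sizeBefore_add_card_block hkb, pow_add, mul_div_cancel_left₀ _ (pow_ne_zero _ hq0)]
  have hprod : ∀ b, ∏ k ∈ Finset.range (b + 1), treeFactor q T s k ≠ 0 := fun b =>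
    Finset.prod_ne_zero_iff.2 fun k _ => treeFactor_ne_zero hq k
  -- The tree factors are divided out, since the path recursion does not contain them. Each split
  -- distributes them over the two blocks without loss.
  have key := eq_rowSum_stripState (y := fun k => q ^ sizeBefore T s k) (N := n + 1)
    (fun k _ => pow_ne_zero _ hq0) (fun k l hkl hl => by
      obtain ⟨l, rfl⟩ : ∃ l', l = l' + 1 := ⟨l - 1, by omega⟩
      rw [← hdiv k l (by omega)]
      exact hq _ (card_block_pos E (by omega) (by omega)))
    (fun U b => normSum q (stepRel T s U (U : Set ℕ)ᶜ) (BlockLt s ω) (block T s 0 b) /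
      ∏ k ∈ Finset.range (b + 1), treeFactor q T s k) ?_ ?_ U n (by omega)
  · rw [← key, mul_div_cancel₀ _ (hprod n)]
  · intro U b hb hU
    rw [normSum_block_of_right E hω hq (by omega) (by omega)
      (fun k _ hk => by simpa using hU k hk) (fun k _ hk => by simpa using hU k hk),
      Finset.prod_mul_distrib, ← Finset.range_eq_Ico, mul_div_assoc, div_self (hprod b), mul_one]
    refine Finset.prod_congr rfl fun k hk => ?_
    rw [Finset.mem_range] at hk
    rw [hdiv k b (by omega)]
  · intro U b r hb hrb hr hU
    rw [← add_div, normSum_block_split E hq hrb (by omega) hr,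
      normSum_block_of_right E hω hq (a := r + 1) (by omega) (by omega)
        (fun k hk hk' => by simp [hU k (by omega) hk']) (fun k hk hk' => by
          simpa using hU k (by omega) hk'),
      Finset.prod_mul_distrib, ← Finset.prod_range_mul_prod_Ico _ (show r + 1 ≤ b + 1 by omega),
      Finset.prod_congr rfl (fun k hk => by
        rw [hdiv k b (by have := Finset.mem_Ico.1 hk; omega)] :
        ∀ k ∈ Finset.Ico (r + 1) (b + 1), 1 / (1 - q ^ (block T s k b).card) =
          1 / (1 - q ^ sizeBefore T s (b + 1) / q ^ sizeBefore T s k))]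
    have h1 := hprod r
    have h2 : ∏ k ∈ Finset.Ico (r + 1) (b + 1), treeFactor q T s k ≠ 0 :=
      Finset.prod_ne_zero_iff.2 fun k _ => treeFactor_ne_zero hq k
    generalize (∏ k ∈ Finset.Ico (r + 1) (b + 1),
      1 / (1 - q ^ sizeBefore T s (b + 1) / q ^ sizeBefore T s k)) = w
    field_simp

end Fintype

end MobileSum

/-! ### Comparison of the order and the labels of P with the step relation and the block labeling -/

section MobileOrder

variable {lam mu : YoungDiagram} {V : Type*} [PartialOrder V] {T : HangingTrees lam mu V}
  {s t : ℕ × ℕ} {n : ℕ}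

lemma Mobile.strip_le_strip {c d : {c : ℕ × ℕ // c ∈ skewCells lam mu}} :
    Mobile.strip T c ≤ Mobile.strip T d ↔ d.1 ≤ c.1 := Iff.rfl

lemma Mobile.tree_le_strip {v : V} {c : {c : ℕ × ℕ // c ∈ skewCells lam mu}} :
    Mobile.tree T v ≤ Mobile.strip T c ↔ c.1 ≤ T.cell v := Iff.rfl

lemma Mobile.not_strip_le_tree {v : V} {c : {c : ℕ × ℕ // c ∈ skewCells lam mu}} :
    ¬ Mobile.strip T c ≤ Mobile.tree T v := id

lemma Mobile.strip_lt_strip {c d : {c : ℕ × ℕ // c ∈ skewCells lam mu}} :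
    Mobile.strip T c < Mobile.strip T d ↔ d.1 < c.1 := by
  rw [lt_iff_le_not_ge, lt_iff_le_not_ge, Mobile.strip_le_strip, Mobile.strip_le_strip]

lemma Mobile.tree_lt_strip {v : V} {c : {c : ℕ × ℕ // c ∈ skewCells lam mu}} :
    Mobile.tree T v < Mobile.strip T c ↔ c.1 ≤ T.cell v := by
  rw [lt_iff_le_not_ge, Mobile.tree_le_strip]
  exact and_iff_left Mobile.not_strip_le_tree

lemma Mobile.not_strip_lt_tree {v : V} {c : {c : ℕ × ℕ // c ∈ skewCells lam mu}} :
    ¬ Mobile.strip T c < Mobile.tree T v := fun h => Mobile.not_strip_le_tree h.le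

lemma lt_of_stepRel (E : StripEnds lam mu s t n) {x y : Mobile T}
    (h : stepRel T s (upSteps lam mu s) (upSteps lam mu s : Set ℕ)ᶜ x y) : x < y := by
  induction x using Mobile.ind with
  | strip c =>
    induction y using Mobile.ind with
    | strip d =>
      rw [Mobile.strip_lt_strip]
      obtain ⟨c, hc⟩ := c
      obtain ⟨d, hd⟩ := d
      rcases h with ⟨h1, h2⟩ | ⟨h1, h2⟩
      · rw [Finset.mem_coe, E.idx_mem_upSteps hc] at h2
        obtain ⟨h2, h3⟩ := h2
        obtain ⟨i, j⟩ := c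
        obtain ⟨i, rfl⟩ : ∃ i', i = i' + 1 := ⟨i - 1, by simp only at h2; omega⟩
        have h4 := E.idx_inj hd h3 (by rw [h1]; exact (E.idx_up hc h3).symm)
        simp only [h4]
        exact Prod.mk_lt_mk_of_lt_of_le (by simp) le_rfl
      · rw [Set.mem_compl_iff, Finset.mem_coe, E.idx_mem_upSteps hd] at h2
        rcases E.of_idx_eq_add_one hd hc h1 with h3 | h3
        · simp only [h3]
          exact Prod.mk_lt_mk_of_le_of_lt le_rfl (by simp)
        -- In this case the cells lie in one column and the step is upward, contrary to `h2`.
        · simp only [h3] at h2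
          exact (h2 ⟨by simp, by simpa using hc⟩).elim
    | tree w => exact h.elim
  | tree v =>
    induction y using Mobile.ind with
    | strip d => exact Mobile.tree_lt_strip.2 (le_of_eq h.symm)
    | tree w => exact Mobile.tree_lt_tree.2 h

/-- Together with `lt_of_stepRel` this shows that the steps of the strip generate the order of P, as
`normSum_lt_eq` requires. The witness is the neighbour of `x` in the direction of `y`, which lies in
the strip by convexity of skew shapes. -/
lemma exists_stepRel_of_lt (E : StripEnds lam mu s t n) {x y : Mobile T} (h : x < y) :
    ∃ z, stepRel T s (upSteps lam mu s) (upSteps lam mu s : Set ℕ)ᶜ x z ∧ z ≤ y := by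
  induction x using Mobile.ind with
  | strip c =>
    induction y using Mobile.ind with
    | strip d =>
      rw [Mobile.strip_lt_strip] at h
      obtain ⟨⟨i, j⟩, hc⟩ := c
      obtain ⟨⟨i', j'⟩, hd⟩ := d
      have hle : i' ≤ i ∧ j' ≤ j := h.le
      by_cases hi : i' < i
      · obtain ⟨i, rfl⟩ : ∃ k, i = k + 1 := ⟨i - 1, by omega⟩
        have he : (i, j) ∈ skewCells lam mu := mem_skewCells_of_le hd hc
          ⟨by simp; omega, by simp; omega⟩ ⟨by simp, by simp⟩
        refine ⟨Mobile.strip T ⟨(i, j), he⟩, Or.inl ⟨E.idx_up hc he, ?_⟩, ?_⟩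
        · rw [Finset.mem_coe, E.idx_mem_upSteps hc]
          exact ⟨by simp, by simpa using he⟩
        · exact Mobile.strip_le_strip.2 ⟨by simp; omega, by simp; omega⟩
      · have hi' : i' = i := by omega
        subst hi'
        have hj : j' < j := lt_of_le_of_ne hle.2 (by rintro rfl; exact lt_irrefl _ h)
        obtain ⟨j, rfl⟩ : ∃ k, j = k + 1 := ⟨j - 1, by omega⟩
        have he : (i', j) ∈ skewCells lam mu := mem_skewCells_of_le hd hc
          ⟨by simp, by simp; omega⟩ ⟨by simp, by simp⟩
        refine ⟨Mobile.strip T ⟨(i', j), he⟩, Or.inr ⟨E.idx_right he hc, ?_⟩, ?_⟩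
        · rw [Set.mem_compl_iff, Finset.mem_coe, E.idx_mem_upSteps he]
          rintro ⟨h1, h2⟩
          -- If the strip also went up from this cell, its right neighbour would be diagonally below
          -- a cell of the strip and hence outside λ.
          refine E.strip.not_mem_of_mem_skewCells h2 ?_
          have e : i' - 1 + 1 = i' := by simp only at h1; omega
          rw [e]
          exact (mem_skewCells.1 hc).1
        · exact Mobile.strip_le_strip.2 ⟨by simp, by simp; omega⟩
    | tree w => exact (Mobile.not_strip_lt_tree h).elim
  | tree v =>
    induction y using Mobile.ind with
    | strip d => exact ⟨Mobile.strip T ⟨T.cell v, T.cell_mem v⟩, rfl, Mobile.tree_lt_strip.1 h⟩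
    | tree w => exact ⟨Mobile.tree T w, Mobile.tree_lt_tree.1 h, le_rfl⟩

variable [Fintype V] {ω : Mobile T ≃ Fin (Fintype.card (Mobile T))}

lemma strip_label_lt (E : StripEnds lam mu s t n) (hω : IsInvLabeling T ω)
    {c d : {c : ℕ × ℕ // c ∈ skewCells lam mu}} :
    ω (Mobile.strip T c) < ω (Mobile.strip T d) ↔ idx s d.1 < idx s c.1 := by
  have key : ∀ c d : {c : ℕ × ℕ // c ∈ skewCells lam mu}, idx s d.1 < idx s c.1 →
      ω (Mobile.strip T c) < ω (Mobile.strip T d) := fun c d h => hω.reversed_schur d c (by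
    have h1 := E.content_eq c.2
    have h2 := E.content_eq d.2
    simp only [content] at h1 h2
    omega)
  refine ⟨fun h => ?_, key c d⟩
  by_contra hcon
  rcases (not_lt.1 hcon).lt_or_eq with h1 | h1
  · exact lt_asymm h (key d c h1)
  · rw [(Mobile.strip_eq_strip E).2 h1] at h
    exact lt_irrefl _ h

lemma strip_label_lt_tree (hω : IsInvLabeling T ω)
    {c : {c : ℕ × ℕ // c ∈ skewCells lam mu}} {v : V} :
    ω (Mobile.strip T c) < ω (Mobile.tree T v) ↔ (T.cell v).2 < c.1.2 := by
  rw [← not_le, ← not_iff_not, not_not, not_lt, ← hω.column c v, le_iff_lt_or_eq,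
    or_iff_left fun h => Mobile.tree_ne_strip v c (ω.injective h)]

/-- Between different columns the cell carrying `v` separates the two labels; within one column this
is the labeling from top to bottom. Hence both labelings order the tree vertices alike. -/
lemma tree_label_lt (E : StripEnds lam mu s t n) (hω : IsInvLabeling T ω) {v w : V}
    (h : idx s (T.cell w) < idx s (T.cell v)) : ω (Mobile.tree T v) < ω (Mobile.tree T w) := by
  have h1 := E.of_idx_lt (T.cell_mem w) (T.cell_mem v) h
  rcases h1.2.lt_or_eq with h2 | h2
  · exact ((hω.column ⟨T.cell v, T.cell_mem v⟩ v).2 le_rfl).trans ((strip_label_lt_tree hω).2 h2)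
  · exact hω.top_to_bottom v w h2.symm
      ((E.idx_lt_iff_of_col_eq (T.cell_mem w) (T.cell_mem v) h2).1 h)

lemma blockLt_tree_tree (E : StripEnds lam mu s t n) (hω : IsInvLabeling T ω) {v w : V} :
    BlockLt s ω (Mobile.tree T v) (Mobile.tree T w) ↔
      ω (Mobile.tree T v) < ω (Mobile.tree T w) := by
  rw [BlockLt, Mobile.cell_tree, Mobile.cell_tree]
  refine ⟨fun h => h.elim (tree_label_lt E hω) fun h => h.2, fun h => ?_⟩
  rcases lt_trichotomy (idx s (T.cell w)) (idx s (T.cell v)) with h1 | h1 | h1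
  · exact Or.inl h1
  · exact Or.inr ⟨h1.symm, h⟩
  · exact (lt_asymm h (tree_label_lt E hω h1)).elim

lemma blockLt_strip_strip (E : StripEnds lam mu s t n) (hω : IsInvLabeling T ω)
    {c d : {c : ℕ × ℕ // c ∈ skewCells lam mu}} :
    BlockLt s ω (Mobile.strip T c) (Mobile.strip T d) ↔
      ω (Mobile.strip T c) < ω (Mobile.strip T d) := by
  rw [BlockLt, strip_label_lt E hω, Mobile.cell_strip, Mobile.cell_strip]
  omega

lemma blockLt_strip_tree (E : StripEnds lam mu s t n) (hω : IsInvLabeling T ω)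
    {c : {c : ℕ × ℕ // c ∈ skewCells lam mu}} {v : V} :
    BlockLt s ω (Mobile.strip T c) (Mobile.tree T v) ↔ idx s (T.cell v) < idx s c.1 := by
  rw [BlockLt, strip_label_lt_tree hω, Mobile.cell_strip, Mobile.cell_tree]
  refine or_iff_left ?_
  rintro ⟨h1, h2⟩
  rw [E.idx_inj c.2 (T.cell_mem v) h1] at h2
  exact lt_irrefl _ h2

lemma blockLt_tree_strip (E : StripEnds lam mu s t n) (hω : IsInvLabeling T ω)
    {c : {c : ℕ × ℕ // c ∈ skewCells lam mu}} {v : V} :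
    BlockLt s ω (Mobile.tree T v) (Mobile.strip T c) ↔ idx s c.1 ≤ idx s (T.cell v) := by
  rw [BlockLt, hω.column, Mobile.cell_strip, Mobile.cell_tree]
  constructor
  · omega
  · intro h
    rcases h.lt_or_eq with h1 | h1
    · exact Or.inl h1
    · exact Or.inr ⟨h1.symm, by rw [E.idx_inj c.2 (T.cell_mem v) h1]⟩

open Classical in
/-- The number of vertices that hang on the cells strictly below `c` in its column. -/
def treesBelow (T : HangingTrees lam mu V) (c : ℕ × ℕ) : ℕ :=
  (Finset.univ.filter fun v : V => (T.cell v).2 = c.2 ∧ c.1 < (T.cell v).1).card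

lemma Mobile.sum_eq (F : Mobile T → ℕ) :
    ∑ x, F x = ∑ c, F (Mobile.strip T c) + ∑ v, F (Mobile.tree T v) :=
  Fintype.sum_sum_type (α₁ := {c : ℕ × ℕ // c ∈ skewCells lam mu}) (α₂ := V) F

/-- Passing from a labeling `ω_inv` to the block labeling. -/
lemma normSum_blockLt {K : Type*} [Field K] {q : K} (E : StripEnds lam mu s t n)
    (hω : IsInvLabeling T ω) (hq : ∀ n, 0 < n → 1 - q ^ n ≠ 0) :
    normSum q (· < ·) (BlockLt s ω) Finset.univ =
      q ^ (∑ c ∈ skewCells lam mu, treesBelow T c) *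
        normSum q (· < ·) (fun x y => ω x < ω y) Finset.univ := by
  classical
  rw [normSum_change_labels (I := fun x y => ω x < ω y) hq]
  · congr 2
    rw [Mobile.sum_eq]
    have e1 : ∀ v : V, (Finset.univ.filter fun y : Mobile T => y < Mobile.tree T v ∧
        BlockLt s ω (Mobile.tree T v) y ∧ ¬ ω (Mobile.tree T v) < ω y).card = 0 := by
      intro v
      rw [Finset.card_eq_zero, Finset.filter_eq_empty_iff]
      rintro y -
      induction y using Mobile.ind with
      | strip c => exact fun h => Mobile.not_strip_lt_tree h.1
      | tree w =>
        rw [blockLt_tree_tree E hω]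
        exact fun h => h.2.2 h.2.1
    have e2 : ∀ c : {c : ℕ × ℕ // c ∈ skewCells lam mu},
        (Finset.univ.filter fun y : Mobile T => y < Mobile.strip T c ∧
        BlockLt s ω (Mobile.strip T c) y ∧ ¬ ω (Mobile.strip T c) < ω y).card =
          treesBelow T c.1 := by
      intro c
      rw [treesBelow, ← Finset.card_map ⟨Mobile.tree T, Mobile.tree_injective⟩]
      congr 1
      ext y
      simp only [Finset.mem_filter, Finset.mem_univ, true_and, Finset.mem_map,
        Function.Embedding.coeFn_mk]
      induction y using Mobile.ind with
      | strip d =>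
        rw [blockLt_strip_strip E hω]
        simp only [Mobile.tree_ne_strip, and_false, exists_false, iff_false]
        exact fun h => h.2.2 h.2.1
      | tree v =>
        rw [blockLt_strip_tree E hω, strip_label_lt_tree hω, Mobile.tree_lt_strip]
        simp only [Mobile.tree_injective.eq_iff, exists_eq_right]
        constructor
        · rintro ⟨h1, h2, h3⟩
          have h4 : (T.cell v).2 = c.1.2 :=
            -- The block labeling forces the tree to hang weakly to the left of `c`, the order of P
            -- weakly to the right, so the column is the same.
            le_antisymm (E.of_idx_lt (T.cell_mem v) c.2 h2).2 h1.2
          exact ⟨h4, (E.idx_lt_iff_of_col_eq (T.cell_mem v) c.2 h4).1 h2⟩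
        · rintro ⟨h1, h2⟩
          exact ⟨⟨h2.le, h1.ge⟩, (E.idx_lt_iff_of_col_eq (T.cell_mem v) c.2 h1).2 h2, by omega⟩
    have e3 : ∑ c : {c : ℕ × ℕ // c ∈ skewCells lam mu}, treesBelow T c.1 =
        ∑ c ∈ skewCells lam mu, treesBelow T c :=
      Finset.sum_coe_sort (skewCells lam mu) (treesBelow T)
    rw [← e3, ← add_zero (∑ c : {c : ℕ × ℕ // c ∈ skewCells lam mu}, treesBelow T c.1)]
    refine congrArg₂ (· + ·) (Finset.sum_congr rfl fun c _ => ?_)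
      (Finset.sum_eq_zero fun v _ => ?_)
    · convert e2 c
    · convert e1 v
  · intro x y hxy h
    induction x using Mobile.ind <;> induction y using Mobile.ind
    · exact (blockLt_strip_strip E hω).2 h
    · rename_i c v
      rw [strip_label_lt_tree hω] at h
      exact (blockLt_strip_tree E hω).2 (E.idx_lt_of_col_lt (T.cell_mem v) c.2 h)
    · rename_i v c
      rw [hω.column] at h
      rw [blockLt_tree_strip E hω]
      -- If the tree hung on an earlier cell, it would hang in the column of `c` and below `c`,
      -- making `v` smaller than `c` in P. That pair is excluded by `hxy`: a smaller element never
      -- comes later, so its label comparison in this direction is irrelevant.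
      by_contra hcon
      have h1 := E.of_idx_lt (T.cell_mem v) c.2 (not_le.1 hcon)
      exact hxy (Mobile.tree_lt_strip.2 ⟨h1.1, h⟩)
    · exact (blockLt_tree_tree E hω).2 h
  · intro x y hxy h h'
    induction x using Mobile.ind <;> induction y using Mobile.ind
    · exact (h' ((blockLt_strip_strip E hω).1 h)).elim
    · rename_i c v
      rw [blockLt_strip_tree E hω] at h
      rw [strip_label_lt_tree hω, not_lt] at h'
      exact Mobile.tree_lt_strip.2 ⟨(E.of_idx_lt (T.cell_mem v) c.2 h).1, h'⟩
    · rename_i v c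
      rw [blockLt_tree_strip E hω] at h
      rw [hω.column] at h'
      rcases h.lt_or_eq with h1 | h1
      · exact (h' (E.of_idx_lt c.2 (T.cell_mem v) h1).2).elim
      · exact (h' (by rw [E.idx_inj c.2 (T.cell_mem v) h1])).elim
    · exact (h' ((blockLt_tree_tree E hω).1 h)).elim

/-- The generating function of a mobile tree poset as a path sum. -/
lemma normSum_mobile {K : Type*} [Field K] {q : K} (E : StripEnds lam mu s t n)
    (hω : IsInvLabeling T ω) (hq0 : q ≠ 0) (hq : ∀ n, 0 < n → 1 - q ^ n ≠ 0) :
    q ^ (∑ c ∈ skewCells lam mu, treesBelow T c) *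
        normSum q (· < ·) (fun x y => ω x < ω y) Finset.univ =
      (∏ v : V, 1 / (1 - q ^ treeHook v)) * rowSum (q ^ sizeBefore T s (n + 1))
        (stripState (fun k => q ^ sizeBefore T s k) (upSteps lam mu s) n) := by
  classical
  have e1 : (Finset.univ : Finset (Mobile T)) = block T s 0 n := by
    ext x
    simp [mem_block, E.idx_le x.cell_mem]
  have e2 : ∏ k ∈ Finset.range (n + 1), treeFactor q T s k =
      ∏ v : V, 1 / (1 - q ^ treeHook v) := by
    rw [← Finset.prod_fiberwise_of_maps_to (s := Finset.univ) (t := Finset.range (n + 1))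
      (g := fun v => idx s (T.cell v))]
    · rfl
    · intro v _
      rw [Finset.mem_range, Nat.lt_succ_iff]
      exact E.idx_le (T.cell_mem v)
  rw [← normSum_blockLt E hω hq, normSum_lt_eq hq (fun x y => lt_of_stepRel E)
    (fun x y => exists_stepRel_of_lt E) (fun _ _ _ _ => Finset.mem_univ _), e1,
    normSum_block_eq E hω hq0 hq, e2]

end MobileOrder

/-! ### Excited diagrams and lattice paths -/

section Paths

variable {lam mu : YoungDiagram} {s t e : ℕ × ℕ} {n : ℕ} {γ : Finset (ℕ × ℕ)}

/-- `IsPath lam s e γ`: the set `γ` consists of the cells of a lattice path in `lam` from `s` to `e`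
with steps upwards and to the right. -/
inductive IsPath (lam : YoungDiagram) (s : ℕ × ℕ) : ℕ × ℕ → Finset (ℕ × ℕ) → Prop
  | start : IsPath lam s s {s}
  -- Steps upwards need no membership condition because λ contains the cell above each of its cells.
  | up (i j : ℕ) (γ : Finset (ℕ × ℕ)) : IsPath lam s (i + 1, j) γ →
      IsPath lam s (i, j) (insert (i, j) γ)
  | right (i j : ℕ) (γ : Finset (ℕ × ℕ)) : (i, j + 1) ∈ lam → IsPath lam s (i, j) γ →
      IsPath lam s (i, j + 1) (insert (i, j + 1) γ)

namespace IsPath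

lemma end_mem (h : IsPath lam s e γ) : e ∈ γ := by
  cases h <;> simp

lemma start_mem (h : IsPath lam s e γ) : s ∈ γ := by
  induction h with
  | start => simp
  | up i j γ _ ih => exact Finset.mem_insert_of_mem ih
  | right i j γ _ _ ih => exact Finset.mem_insert_of_mem ih

lemma subset (hs : s ∈ lam) (h : IsPath lam s e γ) : γ ⊆ lam.cells := by
  induction h with
  | start => simpa using hs
  | up i j γ h ih =>
    have := ih h.end_mem
    rw [YoungDiagram.mem_cells] at this
    refine Finset.insert_subset ?_ ih
    rw [YoungDiagram.mem_cells]
    exact lam.up_left_mem (by omega) le_rfl this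
  | right i j γ hl h ih => exact Finset.insert_subset (by simpa using hl) ih

lemma bounds (h : IsPath lam s e γ) :
    ∀ u ∈ γ, e.1 ≤ u.1 ∧ u.1 ≤ s.1 ∧ s.2 ≤ u.2 ∧ u.2 ≤ e.2 := by
  induction h with
  | start => simp
  | up i j γ h ih =>
    intro u hu
    have h0 := ih _ h.end_mem
    simp only at h0 ⊢
    rcases Finset.mem_insert.1 hu with rfl | hu
    · simp only
      omega
    · have := ih u hu
      simp only at this
      omega
  | right i j γ _ h ih =>
    intro u hu
    have h0 := ih _ h.end_mem
    simp only at h0 ⊢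
    rcases Finset.mem_insert.1 hu with rfl | hu
    · simp only
      omega
    · have := ih u hu
      simp only at this
      omega

lemma comparable (h : IsPath lam s e γ) :
    ∀ u ∈ γ, ∀ w ∈ γ, (u.1 ≤ w.1 ∧ w.2 ≤ u.2) ∨ (w.1 ≤ u.1 ∧ u.2 ≤ w.2) := by
  induction h with
  | start => simp
  | up i j γ h ih =>
    intro u hu w hw
    have hb := h.bounds
    simp only at hb
    rcases Finset.mem_insert.1 hu with rfl | hu <;> rcases Finset.mem_insert.1 hw with rfl | hw
    · simp
    · have := hb w hw
      simp only
      omega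
    · have := hb u hu
      simp only
      omega
    · exact ih u hu w hw
  | right i j γ _ h ih =>
    intro u hu w hw
    have hb := h.bounds
    simp only at hb
    rcases Finset.mem_insert.1 hu with rfl | hu <;> rcases Finset.mem_insert.1 hw with rfl | hw
    · simp
    · have := hb w hw
      simp only
      omega
    · have := hb u hu
      simp only
      omega
    · exact ih u hu w hw

lemma exists_content_eq (h : IsPath lam s e γ) :
    ∀ k, content s ≤ k → k ≤ content e → ∃ u ∈ γ, content u = k := by
  induction h with
  | start => exact fun k h1 h2 => ⟨s, by simp, le_antisymm h1 h2⟩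
  | up i j γ h ih =>
    intro k h1 h2
    rcases h2.eq_or_lt with h3 | h3
    · exact ⟨_, Finset.mem_insert_self _ _, h3.symm⟩
    · obtain ⟨u, hu, hk⟩ := ih k h1 (by simp only [content] at h3 ⊢; omega)
      exact ⟨u, Finset.mem_insert_of_mem hu, hk⟩
  | right i j γ _ h ih =>
    intro k h1 h2
    rcases h2.eq_or_lt with h3 | h3
    · exact ⟨_, Finset.mem_insert_self _ _, h3.symm⟩
    · obtain ⟨u, hu, hk⟩ := ih k h1 (by simp only [content] at h3 ⊢; omega)
      exact ⟨u, Finset.mem_insert_of_mem hu, hk⟩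

/-- Flipping a corner of a path, to the upper left. -/
lemma flip_up_left (h : IsPath lam s e γ) {i j : ℕ} (h1 : (i + 1, j) ∈ γ)
    (h2 : (i + 1, j + 1) ∈ γ) (h3 : (i, j + 1) ∈ γ) :
    IsPath lam s e (insert (i, j) (γ.erase (i + 1, j + 1))) := by
  induction h with
  | start =>
    rw [Finset.mem_singleton] at h1 h2
    rw [← h1] at h2
    simp at h2
  | up a b γ h ih =>
    -- If the corner is the end of the path, its last two steps are right and up; they are
    -- exchanged. Otherwise the corner lies in the shorter path.
    by_cases hab : i = a ∧ j + 1 = b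
    · obtain ⟨rfl, rfl⟩ := hab
      rw [Finset.mem_insert, or_iff_right (by simp)] at h1
      clear ih h2 h3
      generalize he : (i + 1, j + 1) = e' at h
      have hb := h.bounds
      cases h with
      | start =>
        have := hb _ h1
        rw [← he] at this
        simp at this
      | up a' b' γ' h' =>
        have := h'.bounds (i + 1, j) (by
          rcases Finset.mem_insert.1 h1 with h1 | h1
          · rw [← h1] at he
            simp at he
          · exact h1)
        simp only [Prod.mk.injEq] at he this
        omega
      | right a' b' γ' hl h' =>
        obtain ⟨rfl, he⟩ := Prod.mk.inj he
        obtain rfl : j = b' := by omega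
        have hn : (i + 1, j + 1) ∉ γ' := fun hm => by
          have := (h'.bounds _ hm).2.2.2
          simp at this
        have h4 : (i, j + 1) ∈ lam := lam.up_left_mem (by omega) le_rfl hl
        have h5 := (h'.up i j γ').right i j _ h4
        convert h5 using 1
        rw [Finset.erase_insert_of_ne (by simp), Finset.erase_insert hn, Finset.insert_comm]
    · have e1 : (i, j + 1) ≠ (a, b) := by simpa using hab
      have h3' : (i, j + 1) ∈ γ := (Finset.mem_insert.1 h3).resolve_left e1
      have hb := h.bounds _ h3'
      simp only at hb
      have e2 : (i + 1, j) ≠ (a, b) := by rintro ⟨⟩; omega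
      have e3 : (i + 1, j + 1) ≠ (a, b) := by rintro ⟨⟩; omega
      have := (ih ((Finset.mem_insert.1 h1).resolve_left e2)
        ((Finset.mem_insert.1 h2).resolve_left e3) h3').up
      rwa [Finset.erase_insert_of_ne e3.symm, Finset.insert_comm]
  | right a b γ hl h ih =>
    have hb := h.bounds
    simp only at hb
    have e1 : (i, j + 1) ≠ (a, b + 1) := by
      rintro ⟨⟩
      have := hb _ ((Finset.mem_insert.1 h2).resolve_left (by simp))
      simp only at this
      omega
    have h3' : (i, j + 1) ∈ γ := (Finset.mem_insert.1 h3).resolve_left e1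
    have h3b := hb _ h3'
    simp only at h3b
    have e2 : (i + 1, j) ≠ (a, b + 1) := by rintro ⟨⟩; omega
    have e3 : (i + 1, j + 1) ≠ (a, b + 1) := by rintro ⟨⟩; omega
    have := (ih ((Finset.mem_insert.1 h1).resolve_left e2)
      ((Finset.mem_insert.1 h2).resolve_left e3) h3').right a b _ hl
    rwa [Finset.erase_insert_of_ne e3.symm, Finset.insert_comm]

/-- Flipping a corner of a path, to the lower right. -/
lemma flip_down_right (h : IsPath lam s e γ) {i j : ℕ} (hl : (i + 1, j + 1) ∈ lam)
    (h1 : (i + 1, j) ∈ γ) (h2 : (i, j) ∈ γ) (h3 : (i, j + 1) ∈ γ) :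
    IsPath lam s e (insert (i + 1, j + 1) (γ.erase (i, j))) := by
  induction h with
  | start =>
    rw [Finset.mem_singleton] at h1 h2
    rw [← h1] at h2
    simp at h2
  | up a b γ h ih =>
    have hb := h.bounds
    simp only at hb
    have e1 : (i, j + 1) ≠ (a, b) := by
      rintro ⟨⟩
      have := hb _ ((Finset.mem_insert.1 h2).resolve_left (by simp))
      simp only at this
      omega
    have h3' : (i, j + 1) ∈ γ := (Finset.mem_insert.1 h3).resolve_left e1
    have h3b := hb _ h3'
    simp only at h3b
    have e2 : (i + 1, j) ≠ (a, b) := by rintro ⟨⟩; omega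
    have e3 : (i, j) ≠ (a, b) := by rintro ⟨⟩; omega
    have := (ih ((Finset.mem_insert.1 h1).resolve_left e2)
      ((Finset.mem_insert.1 h2).resolve_left e3) h3').up
    rwa [Finset.erase_insert_of_ne e3.symm, Finset.insert_comm]
  | right a b γ hl' h ih =>
    -- For a corner at the end of the path the last two steps, up and right, are exchanged.
    by_cases hab : i = a ∧ j = b
    · obtain ⟨rfl, rfl⟩ := hab
      rw [Finset.mem_insert, or_iff_right (by simp)] at h1
      clear ih h2 h3
      generalize he : (i, j) = e' at h
      have hb := h.bounds
      cases h with
      | start =>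
        have := hb _ h1
        rw [← he] at this
        simp at this
      | up a' b' γ' h' =>
        obtain ⟨rfl, rfl⟩ := Prod.mk.inj he
        have hn : (i, j) ∉ γ' := fun hm => by
          have := (h'.bounds _ hm).1
          simp at this
        have h5 := (h'.right (i + 1) j γ' hl).up i (j + 1) _
        convert h5 using 1
        rw [Finset.erase_insert_of_ne (by simp), Finset.erase_insert hn, Finset.insert_comm]
      | right a' b' γ' hl h' =>
        have := h'.bounds (i + 1, j) (by
          rcases Finset.mem_insert.1 h1 with h1 | h1
          · rw [← h1] at he
            simp at he
          · exact h1)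
        simp only [Prod.mk.injEq] at he this
        omega
    · have hb := h.bounds
      simp only at hb
      have e1 : (i, j + 1) ≠ (a, b + 1) := by
        rintro ⟨⟩
        simp at hab
      have h3' : (i, j + 1) ∈ γ := (Finset.mem_insert.1 h3).resolve_left e1
      have h3b := hb _ h3'
      simp only at h3b
      have e2 : (i + 1, j) ≠ (a, b + 1) := by rintro ⟨⟩; omega
      have e3 : (i, j) ≠ (a, b + 1) := by rintro ⟨⟩; omega
      have := (ih ((Finset.mem_insert.1 h1).resolve_left e2)
        ((Finset.mem_insert.1 h2).resolve_left e3) h3').right a b _ hl'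
      rwa [Finset.erase_insert_of_ne e3.symm, Finset.insert_comm]

/-- A path that leaves a cell off the rim to the right has a corner that can be flipped to the
lower right. -/
lemma exists_corner_of_right (hs : (s.1 + 1, s.2) ∉ lam) (h : IsPath lam s e γ)
    (hl : (e.1 + 1, e.2 + 1) ∈ lam) :
    ∃ i j, (i + 1, j + 1) ∈ lam ∧ (i + 1, j) ∈ γ ∧ (i, j) ∈ γ ∧
      (i, j + 1) ∈ insert (e.1, e.2 + 1) γ := by
  induction h with
  | start => exact (hs (lam.up_left_mem le_rfl (by omega) hl)).elim
  | up i j γ h ih =>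
    exact ⟨i, j, hl, Finset.mem_insert_of_mem h.end_mem, by simp, by simp⟩
  | right i j γ hl' h ih =>
    obtain ⟨a, b, h1, h2, h3, h4⟩ := ih (lam.up_left_mem le_rfl (by simp) hl)
    exact ⟨a, b, h1, Finset.mem_insert_of_mem h2, Finset.mem_insert_of_mem h3,
      Finset.mem_insert_of_mem h4⟩

/-- A path to the rim without corners that can be flipped to the lower right stays in the rim. -/
lemma forall_rim (hs : (s.1 + 1, s.2) ∉ lam) (h : IsPath lam s e γ)
    (hγ : ¬ ∃ i j, (i + 1, j + 1) ∈ lam ∧ (i + 1, j) ∈ γ ∧ (i, j) ∈ γ ∧ (i, j + 1) ∈ γ)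
    (hl : (e.1 + 1, e.2 + 1) ∉ lam) : ∀ u ∈ γ, (u.1 + 1, u.2 + 1) ∉ lam := by
  induction h with
  | start => simpa using hl
  | up i j γ h ih =>
    intro u hu
    rcases Finset.mem_insert.1 hu with rfl | hu
    · exact hl
    · refine ih ?_ (fun h => hl (lam.up_left_mem (by simp) le_rfl h)) u hu
      rintro ⟨a, b, h1, h2, h3, h4⟩
      exact hγ ⟨a, b, h1, Finset.mem_insert_of_mem h2, Finset.mem_insert_of_mem h3,
        Finset.mem_insert_of_mem h4⟩
  | right i j γ hl' h ih =>
    intro u hu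
    rcases Finset.mem_insert.1 hu with rfl | hu
    · exact hl
    · refine ih ?_ (fun h' => ?_) u hu
      · rintro ⟨a, b, h1, h2, h3, h4⟩
        exact hγ ⟨a, b, h1, Finset.mem_insert_of_mem h2, Finset.mem_insert_of_mem h3,
          Finset.mem_insert_of_mem h4⟩
      · obtain ⟨a, b, h1, h2, h3, h4⟩ := h.exists_corner_of_right hs h'
        exact hγ ⟨a, b, h1, Finset.mem_insert_of_mem h2, Finset.mem_insert_of_mem h3, h4⟩

end IsPath

/-! ### Complements of excited diagrams are the lattice paths along the strip -/

namespace StripEnds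

lemma start_below (E : StripEnds lam mu s t n) : (s.1 + 1, s.2) ∉ lam := fun h => by
  have h1 : (s.1 + 1, s.2) ∈ skewCells lam mu := mem_skewCells.2
    ⟨h, fun hm => (mem_skewCells.1 E.start_mem).2 (mu.up_left_mem (by simp) le_rfl hm)⟩
  have := E.start_le _ h1
  simp only [content] at this
  omega

lemma end_right (E : StripEnds lam mu s t n) : (t.1, t.2 + 1) ∉ lam := fun h => by
  have h1 : (t.1, t.2 + 1) ∈ skewCells lam mu := mem_skewCells.2
    ⟨h, fun hm => (mem_skewCells.1 E.end_mem).2 (mu.up_left_mem le_rfl (by simp) hm)⟩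
  have := E.le_end _ h1
  simp only [content] at this
  omega

lemma idx_start : idx s s = 0 := by simp [idx]

lemma idx_end (E : StripEnds lam mu s t n) : idx s t = n := by
  have := E.content_end
  rw [idx]
  omega

open Classical in
lemma isPath_initial (E : StripEnds lam mu s t n) {k : ℕ} {c : ℕ × ℕ}
    (hc : c ∈ skewCells lam mu) (hk : idx s c = k) :
    IsPath lam s c ((skewCells lam mu).filter fun u => idx s u ≤ k) := by
  induction k generalizing c with
  | zero =>
    have h1 : c = s := E.idx_inj hc E.start_mem (by rw [hk, idx_start])
    subst h1
    have : (skewCells lam mu).filter (fun u => idx c u ≤ 0) = {c} := by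
      ext u
      simp only [Finset.mem_filter, Finset.mem_singleton, Nat.le_zero]
      refine ⟨fun h => E.idx_inj h.1 hc (by rw [h.2, hk]), ?_⟩
      rintro rfl
      exact ⟨hc, hk⟩
    rw [this]
    exact .start
  | succ k ih =>
    have hn := E.idx_le hc
    obtain ⟨d, hd, hdk⟩ := E.exists_idx_eq (k := k) (by omega)
    have h1 := ih hd hdk
    have h2 : (skewCells lam mu).filter (fun u => idx s u ≤ k + 1) =
        insert c ((skewCells lam mu).filter fun u => idx s u ≤ k) := by
      ext u
      simp only [Finset.mem_filter, Finset.mem_insert]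
      constructor
      · rintro ⟨h3, h4⟩
        rcases h4.eq_or_lt with h5 | h5
        · exact Or.inl (E.idx_inj h3 hc (by rw [h5, hk]))
        · exact Or.inr ⟨h3, by omega⟩
      · rintro (rfl | h3)
        · exact ⟨hc, hk.le⟩
        · exact ⟨h3.1, by omega⟩
    rw [h2]
    rcases E.of_idx_eq_add_one hd hc (by omega) with rfl | rfl
    · exact h1.right _ _ _ (mem_skewCells.1 hc).1
    · exact h1.up _ _ _

lemma isPath_skewCells (E : StripEnds lam mu s t n) : IsPath lam s t (skewCells lam mu) := by
  classical
  have h := E.isPath_initial E.end_mem E.idx_end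
  rwa [Finset.filter_true_of_mem fun u hu => E.idx_le hu] at h

/-- The complement of an excited diagram is a path. -/
lemma isPath_of_excited (E : StripEnds lam mu s t n) {D B : Finset (ℕ × ℕ)}
    (h : Excited lam mu D B) : IsPath lam s t (lam.cells \ D) := by
  induction h with
  | base => exact E.isPath_skewCells
  | move D B i j h h1 h2 h3 h4 h5 ih =>
    have hm : ∀ u, u ∈ lam → u ∉ D → u ∈ lam.cells \ D := fun u hu hu' =>
      Finset.mem_sdiff.2 ⟨by simpa using hu, hu'⟩
    have h6 := ih.flip_up_left (hm _ (lam.up_left_mem le_rfl (by simp) h2) h3) (hm _ h2 h5)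
      (hm _ (lam.up_left_mem (by simp) le_rfl h2) h4)
    convert h6 using 1
    ext u
    have hij : (i, j) ∈ lam := lam.up_left_mem (by simp) (by simp) h2
    have hne : (i, j) ≠ (i + 1, j + 1) := by simp
    simp only [Finset.mem_sdiff, Finset.mem_insert, Finset.mem_erase, YoungDiagram.mem_cells]
    by_cases hu : u = (i, j)
    · subst hu
      simp [hij]
    · tauto

/-- The complement of a path is an excited diagram. -/
lemma excited_of_isPath (E : StripEnds lam mu s t n) (hγ : IsPath lam s t γ) :
    ∃ B, Excited lam mu (lam.cells \ γ) B := by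
  have hs := (mem_skewCells.1 E.start_mem).1
  -- Flipping a corner of the path to the lower right moves one cell of the complement up its
  -- diagonal and lowers this sum by two. The flip is undone by an excited move.
  induction hm : ∑ u ∈ lam.cells \ γ, (u.1 + u.2) using Nat.strong_induction_on
    generalizing γ with
  | _ m ih =>
    by_cases hc : ∃ i j, (i + 1, j + 1) ∈ lam ∧ (i + 1, j) ∈ γ ∧ (i, j) ∈ γ ∧ (i, j + 1) ∈ γ
    · obtain ⟨i, j, h1, h2, h3, h4⟩ := hc
      have h5 := hγ.flip_down_right h1 h2 h3 h4
      have hn : (i + 1, j + 1) ∉ γ := fun h => by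
        have := hγ.comparable _ h3 _ h
        simp at this
      have hij : (i, j) ∈ lam := lam.up_left_mem (by simp) (by simp) h1
      have e1 : lam.cells \ insert (i + 1, j + 1) (γ.erase (i, j)) =
          insert (i, j) ((lam.cells \ γ).erase (i + 1, j + 1)) := by
        ext u
        simp only [Finset.mem_sdiff, Finset.mem_insert, Finset.mem_erase, YoungDiagram.mem_cells]
        by_cases hu : u = (i, j)
        · subst hu
          simp [hij]
        · tauto
      have hmem : (i + 1, j + 1) ∈ lam.cells \ γ := Finset.mem_sdiff.2 ⟨by simpa using h1, hn⟩
      obtain ⟨B, hB⟩ := ih _ (by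
        rw [← hm, e1, Finset.sum_insert (by simp [h3]), ← Finset.add_sum_erase _ _ hmem]
        simp only
        omega) h5 rfl
      rw [e1] at hB
      have h6 := Excited.move _ B i j hB (by simp) h1 (by simp [h2]) (by simp [h4]) (by simp)
      refine ⟨insert (i + 1, j) (B.erase (i + 1, j + 1)), ?_⟩
      convert h6 using 1
      ext u
      simp only [Finset.mem_sdiff, Finset.mem_insert, Finset.mem_erase, YoungDiagram.mem_cells]
      by_cases hu : u = (i + 1, j + 1)
      · subst hu
        simp [h1, hn]
      · by_cases hu' : u = (i, j)
        · subst hu'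
          simp [h3]
        · simp [hu, hu']
    · have h1 := hγ.forall_rim E.start_below hc (E.strip.not_mem_of_mem_skewCells E.end_mem)
      have hsub : γ ⊆ skewCells lam mu := by
        intro u hu
        have hul := hγ.subset hs hu
        have hb := hγ.bounds u hu
        rw [YoungDiagram.mem_cells] at hul
        by_contra hcon
        -- A path cell outside the strip would lie in μ, strictly to the upper left of the strip
        -- cell on its diagonal. It would then not be in the rim, although a path without corners to
        -- flip stays there.
        obtain ⟨c, hc, hcu⟩ := E.strip.exists_content_eq E.start_mem E.end_mem
          (k := content u) (by simp only [content]; omega) (by simp only [content]; omega)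
        have hum : u ∈ mu := by
          by_contra h
          exact hcon (mem_skewCells.2 ⟨hul, h⟩)
        obtain ⟨hcl, hcm⟩ := mem_skewCells.1 hc
        have hlt : u.1 < c.1 := by
          by_contra hcon'
          refine hcm (mu.up_left_mem (i2 := u.1) (j2 := u.2) (not_lt.1 hcon') ?_ hum)
          simp only [content] at hcu
          omega
        refine h1 u hu (lam.up_left_mem (i2 := c.1) (j2 := c.2) hlt ?_ hcl)
        simp only [content] at hcu
        omega
      -- The path meets every content from that of `s` to that of `t`, and the strip has one cell
      -- for each.
      have heq : γ = skewCells lam mu := by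
        refine Finset.Subset.antisymm hsub fun c hc => ?_
        obtain ⟨u, hu, hcu⟩ := hγ.exists_content_eq (content c) (E.start_le c hc) (E.le_end c hc)
        rwa [← E.strip.eq_of_content_eq (hsub hu) hc hcu]
      have h2 : lam.cells \ γ = mu.cells := by
        rw [heq, skewCells]
        exact Finset.sdiff_sdiff_eq_self E.strip.le
      rw [h2]
      exact ⟨_, .base⟩

end StripEnds

/-! ### Sums over paths and their upward steps -/

open Classical in
/-- The set of lattice paths from `s` to `e`. -/
def paths (lam : YoungDiagram) (s e : ℕ × ℕ) : Finset (Finset (ℕ × ℕ)) :=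
  lam.cells.powerset.filter (IsPath lam s e)

lemma mem_paths (hs : s ∈ lam) : γ ∈ paths lam s e ↔ IsPath lam s e γ := by
  classical
  rw [paths, Finset.mem_filter, Finset.mem_powerset]
  exact ⟨fun h => h.2, fun h => ⟨h.subset hs, h⟩⟩

/-- The cells from which a path goes upwards. -/
def upCells (γ : Finset (ℕ × ℕ)) : Finset (ℕ × ℕ) :=
  γ.filter fun u => 1 ≤ u.1 ∧ (u.1 - 1, u.2) ∈ γ

/-- By `Excited.broken_iff`, a cell outside `D` is on a broken diagonal exactly when the cell above
it exists and is outside `D` too. -/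
lemma StripEnds.brokenDiagonals_eq (E : StripEnds lam mu s t n) {D B : Finset (ℕ × ℕ)}
    (h : Excited lam mu D B) : brokenDiagonals lam mu D = upCells (lam.cells \ D) := by
  have hex : ∃ B, Excited lam mu D B := ⟨B, h⟩
  rw [brokenDiagonals, dif_pos hex]
  ext ⟨a, b⟩
  rw [(hex.choose_spec.broken_iff E.strip).2]
  simp only [upCells, Finset.mem_filter, Finset.mem_sdiff, YoungDiagram.mem_cells]
  constructor
  · rintro ⟨h1, h2, h3, h4⟩
    exact ⟨⟨h1, h2⟩, h3, lam.up_left_mem (by omega) le_rfl h1, h4⟩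
  · rintro ⟨⟨h1, h2⟩, h3, -, h4⟩
    exact ⟨h1, h2, h3, h4⟩

lemma StripEnds.sum_excitedDiagrams (E : StripEnds lam mu s t n) {M : Type*} [AddCommMonoid M]
    (F : Finset (ℕ × ℕ) → M) :
    ∑ D ∈ excitedDiagrams lam mu, F D = ∑ γ ∈ paths lam s t, F (lam.cells \ γ) := by
  classical
  have hs := (mem_skewCells.1 E.start_mem).1
  refine Finset.sum_nbij' (fun D => lam.cells \ D) (fun γ => lam.cells \ γ) ?_ ?_ ?_ ?_ ?_
  · intro D hD
    obtain ⟨-, B, hB⟩ := Finset.mem_filter.1 hD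
    exact (mem_paths hs).2 (E.isPath_of_excited hB)
  · intro γ hγ
    rw [mem_paths hs] at hγ
    exact Finset.mem_filter.2 ⟨by simp, E.excited_of_isPath hγ⟩
  · intro D hD
    exact Finset.sdiff_sdiff_eq_self (Finset.mem_powerset.1 (Finset.mem_filter.1 hD).1)
  · intro γ hγ
    exact Finset.sdiff_sdiff_eq_self (((mem_paths hs).1 hγ).subset hs)
  · intro D hD
    rw [Finset.sdiff_sdiff_eq_self (Finset.mem_powerset.1 (Finset.mem_filter.1 hD).1)]

lemma mem_upCells {u : ℕ × ℕ} : u ∈ upCells γ ↔ u ∈ γ ∧ 1 ≤ u.1 ∧ (u.1 - 1, u.2) ∈ γ := by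
  simp [upCells]

lemma upCells_singleton : upCells {s} = ∅ := by
  ext u
  simp only [mem_upCells, Finset.mem_singleton, Finset.notMem_empty, iff_false]
  rintro ⟨rfl, h1, h2⟩
  have := congrArg Prod.fst h2
  simp only at this
  omega

lemma IsPath.upCells_up {i j : ℕ} (h : IsPath lam s (i + 1, j) γ) :
    (i, j) ∉ γ ∧ (i + 1, j) ∉ upCells γ ∧
      upCells (insert (i, j) γ) = insert (i + 1, j) (upCells γ) := by
  have hb := h.bounds
  simp only at hb
  have hn : (i, j) ∉ γ := fun hm => by have := hb _ hm; simp at this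
  refine ⟨hn, fun hm => hn (by simpa using (mem_upCells.1 hm).2.2), ?_⟩
  ext ⟨a, b⟩
  simp only [mem_upCells, Finset.mem_insert, Prod.mk.injEq]
  constructor
  · rintro ⟨⟨rfl, rfl⟩ | h1, h2, ⟨h3, h4⟩ | h3⟩
    · omega
    · have := hb _ h3
      simp only at this
      omega
    · left; omega
    · exact Or.inr ⟨h1, h2, h3⟩
  · rintro (⟨rfl, rfl⟩ | ⟨h1, h2, h3⟩)
    · exact ⟨Or.inr h.end_mem, by omega, Or.inl ⟨by omega, rfl⟩⟩
    · exact ⟨Or.inr h1, h2, Or.inr h3⟩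

lemma IsPath.upCells_right {i j : ℕ} (h : IsPath lam s (i, j) γ) :
    (i, j + 1) ∉ γ ∧ upCells (insert (i, j + 1) γ) = upCells γ := by
  have hb := h.bounds
  simp only at hb
  have hn : (i, j + 1) ∉ γ := fun hm => by have := hb _ hm; simp at this
  refine ⟨hn, ?_⟩
  ext ⟨a, b⟩
  simp only [mem_upCells, Finset.mem_insert, Prod.mk.injEq]
  constructor
  · rintro ⟨⟨rfl, rfl⟩ | h1, h2, ⟨h3, h4⟩ | h3⟩
    · omega
    · have := hb _ h3
      simp only at this
      omega
    · have := hb _ h1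
      simp only at this
      omega
    · exact ⟨h1, h2, h3⟩
  · rintro ⟨h1, h2, h3⟩
    exact ⟨Or.inr h1, h2, Or.inr h3⟩

end Paths

/-! ### Hook lengths and path sums -/

section Hooks

variable {lam mu : YoungDiagram} {V : Type*} [PartialOrder V] {T : HangingTrees lam mu V}
  {s t : ℕ × ℕ} {n : ℕ}

/-- The content of the last cell in row `i`. -/
def rowContent (lam : YoungDiagram) (i : ℕ) : ℤ := (lam.rowLen i : ℤ) - 1 - i

/-- The content of the last cell in column `j`. -/
def colContent (lam : YoungDiagram) (j : ℕ) : ℤ := (j : ℤ) - lam.colLen j + 1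

lemma rowLen_eq {i j : ℕ} (h1 : (i, j) ∈ lam) (h2 : (i, j + 1) ∉ lam) : lam.rowLen i = j + 1 := by
  rw [YoungDiagram.mem_iff_lt_rowLen] at h1 h2
  omega

lemma colLen_eq {i j : ℕ} (h1 : (i, j) ∈ lam) (h2 : (i + 1, j) ∉ lam) : lam.colLen j = i + 1 := by
  rw [YoungDiagram.mem_iff_lt_colLen] at h1 h2
  omega

lemma IsBorderStrip.le_iff_content (h : IsBorderStrip lam mu) {i j : ℕ} {c : ℕ × ℕ}
    (hc : c ∈ skewCells lam mu) :
    (i, j) ≤ c ↔ colContent lam j ≤ content c ∧ content c ≤ rowContent lam i := by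
  obtain ⟨a, b⟩ := c
  have hl := (mem_skewCells.1 hc).1
  have hn := h.not_mem_of_mem_skewCells hc
  simp only [content, colContent, rowContent, Prod.mk_le_mk]
  constructor
  · rintro ⟨h1, h2⟩
    have h3 : (a, j) ∈ lam := lam.up_left_mem le_rfl h2 hl
    have h4 : (i, b) ∈ lam := lam.up_left_mem h1 le_rfl hl
    rw [YoungDiagram.mem_iff_lt_colLen] at h3
    rw [YoungDiagram.mem_iff_lt_rowLen] at h4
    omega
  · rintro ⟨h1, h2⟩
    constructor
    · by_contra hcon
      refine hn (lam.up_left_mem (i2 := i) (j2 := b + 1) (by omega) le_rfl ?_)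
      rw [YoungDiagram.mem_iff_lt_rowLen]
      omega
    · by_contra hcon
      refine hn (lam.up_left_mem (i2 := a + 1) (j2 := j) le_rfl (by omega) ?_)
      rw [YoungDiagram.mem_iff_lt_colLen]
      omega

lemma StripEnds.rowContent_le (E : StripEnds lam mu s t n) {i : ℕ} (hi : t.1 ≤ i) :
    rowContent lam i ≤ content t := by
  have h1 := rowLen_eq (mem_skewCells.1 E.end_mem).1 E.end_right
  have h2 := lam.rowLen_anti _ _ hi
  simp only [rowContent, content]
  omega

lemma StripEnds.le_colContent (E : StripEnds lam mu s t n) {j : ℕ} (hj : s.2 ≤ j) :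
    content s ≤ colContent lam j := by
  have h1 := colLen_eq (mem_skewCells.1 E.start_mem).1 E.start_below
  have h2 := lam.colLen_anti _ _ hj
  simp only [colContent, content]
  omega

/-- The hook length counts the cells of the strip to the south-east. -/
lemma StripEnds.hook_eq (E : StripEnds lam mu s t n) {i j : ℕ} (hij : (i, j) ∈ lam)
    (hi : t.1 ≤ i) (hj : s.2 ≤ j) :
    hook lam (i, j) = ((skewCells lam mu).filter fun c => (i, j) ≤ c).card := by
  classical
  have h1 := E.rowContent_le hi
  have h2 := E.le_colContent hj
  have e : ((skewCells lam mu).filter fun c => (i, j) ≤ c).image content =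
      Finset.Icc (colContent lam j) (rowContent lam i) := by
    ext k
    simp only [Finset.mem_image, Finset.mem_filter, Finset.mem_Icc]
    constructor
    · rintro ⟨c, ⟨hc, hle⟩, rfl⟩
      exact (E.strip.le_iff_content hc).1 hle
    · rintro ⟨h3, h4⟩
      obtain ⟨c, hc, rfl⟩ := E.strip.exists_content_eq E.start_mem E.end_mem (k := k)
        (by omega) (by omega)
      exact ⟨c, ⟨hc, (E.strip.le_iff_content hc).2 ⟨h3, h4⟩⟩, rfl⟩
  rw [← Finset.card_image_of_injOn (f := content), e, Int.card_Icc, hook, colContent, rowContent]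
  · have h3 := YoungDiagram.mem_iff_lt_rowLen.1 hij
    have h4 := YoungDiagram.mem_iff_lt_colLen.1 hij
    simp only
    omega
  · intro c hc d hd hcd
    rw [Finset.mem_coe, Finset.mem_filter] at hc hd
    exact E.strip.eq_of_content_eq hc.1 hd.1 hcd

variable [Fintype V]

open Classical in
/-- The number of elements of content at most `k`. -/
def sizeUpTo (T : HangingTrees lam mu V) (k : ℤ) : ℕ :=
  (Finset.univ.filter fun x : Mobile T => content x.cell ≤ k).card

lemma StripEnds.sizeUpTo_eq (E : StripEnds lam mu s t n) (m : ℕ) :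
    sizeUpTo T (content s + m - 1) = sizeBefore T s m := by
  rw [sizeUpTo, sizeBefore]
  congr 1
  ext x
  simp only [Finset.mem_filter, Finset.mem_univ, true_and]
  have := E.content_eq x.cell_mem
  omega

/-- The modified hook length counts the elements of P belonging to cells south-east of (i,j), and by
`le_iff_content` these are the cells with contents in an interval. A difference of a row quantity
and a column quantity results, so q^{h'} is a quotient of a row parameter by a column parameter. -/
lemma StripEnds.mobileHook_add (E : StripEnds lam mu s t n) {i j : ℕ} (hij : (i, j) ∈ lam)
    (hi : t.1 ≤ i) (hj : s.2 ≤ j) :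
    mobileHook T (i, j) + sizeUpTo T (colContent lam j - 1) = sizeUpTo T (rowContent lam i) := by
  classical
  have h1 : mobileHook T (i, j) =
      (Finset.univ.filter fun x : Mobile T => (i, j) ≤ x.cell).card := by
    rw [mobileHook, E.hook_eq hij hi hj, Finset.card_filter, Finset.card_filter,
      Finset.card_filter, Mobile.sum_eq]
    congr 1
    exact (Finset.sum_coe_sort (skewCells lam mu) fun c => if (i, j) ≤ c then 1 else 0).symm
  rw [h1, sizeUpTo, sizeUpTo, ← Finset.card_union_of_disjoint]
  · congr 1
    ext x
    simp only [Finset.mem_union, Finset.mem_filter, Finset.mem_univ, true_and,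
      E.strip.le_iff_content x.cell_mem]
    have h3 := YoungDiagram.mem_iff_lt_rowLen.1 hij
    have h4 := YoungDiagram.mem_iff_lt_colLen.1 hij
    simp only [colContent, rowContent]
    omega
  · rw [Finset.disjoint_left]
    intro x hx hx'
    rw [Finset.mem_filter, E.strip.le_iff_content x.cell_mem] at hx
    have := (Finset.mem_filter.1 hx').2
    omega

variable {K : Type*} [Field K]

/-- The weight of a lattice path. -/
def pathWeight (q : K) (T : HangingTrees lam mu V) (γ : Finset (ℕ × ℕ)) : K :=
  (∏ u ∈ upCells γ, q ^ mobileHook T u) * ∏ u ∈ γ, 1 / (1 - q ^ mobileHook T u)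

/-- The sum of the weights of the lattice paths from `s` to `e`. -/
def pathSum (q : K) (T : HangingTrees lam mu V) (s e : ℕ × ℕ) : K :=
  ∑ γ ∈ paths lam s e, pathWeight q T γ

variable {q : K}

lemma pathSum_eq_zero (hs : s ∈ lam) {e : ℕ × ℕ} (h : e ∉ lam ∨ e.2 < s.2 ∨ s.1 < e.1) :
    pathSum q T s e = 0 := by
  rw [pathSum, Finset.sum_eq_zero]
  intro γ hγ
  rw [mem_paths hs] at hγ
  have h1 := hγ.subset hs hγ.end_mem
  rw [YoungDiagram.mem_cells] at h1
  have h2 := hγ.bounds _ hγ.end_mem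
  rcases h with h | h | h
  · exact (h h1).elim
  · omega
  · omega

open Classical in
/-- The recursion for path sums by the last step. -/
lemma pathSum_rec (hs : s ∈ lam) {i j : ℕ} (hij : (i, j) ∈ lam) :
    pathSum q T s (i, j) = ((if s.2 < j then pathSum q T s (i, j - 1) else 0) +
      (pathSum q T s (i + 1, j) * q ^ mobileHook T (i + 1, j) + if (i, j) = s then 1 else 0)) /
        (1 - q ^ mobileHook T (i, j)) := by
  have hstart : IsPath lam s s {s} := .start
  have hup : ∀ γ, IsPath lam s (i + 1, j) γ → pathWeight q T (insert (i, j) γ) =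
      pathWeight q T γ * q ^ mobileHook T (i + 1, j) / (1 - q ^ mobileHook T (i, j)) := by
    intro γ h
    obtain ⟨h1, h2, h3⟩ := h.upCells_up
    rw [pathWeight, h3, Finset.prod_insert h2, Finset.prod_insert h1, pathWeight]
    ring
  have hright : ∀ b γ, j = b + 1 → IsPath lam s (i, b) γ → pathWeight q T (insert (i, j) γ) =
      pathWeight q T γ / (1 - q ^ mobileHook T (i, j)) := by
    rintro b γ rfl h
    obtain ⟨h1, h2⟩ := h.upCells_right
    rw [pathWeight, h2, Finset.prod_insert h1, pathWeight]
    ring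
  by_cases he : (i, j) = s
  · have h1 : paths lam s (i, j) = {{s}} := by
      ext γ
      rw [mem_paths hs, Finset.mem_singleton]
      constructor
      · intro h
        generalize hx : (i, j) = x at h he
        cases h with
        | start => rfl
        | up a b γ h =>
          have := (h.bounds _ h.start_mem).1
          simp only [← he] at this
          omega
        | right a b γ _ h =>
          have := (h.bounds _ h.start_mem).2.2.2
          simp only [← he] at this
          omega
      · rintro rfl
        exact he ▸ hstart
    have h2 : s.2 = j := by rw [← he]
    have h3 : s.1 = i := by rw [← he]
    rw [if_neg (by omega), if_pos he, pathSum_eq_zero hs (e := (i + 1, j)) (by simp; omega),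
      pathSum, h1, Finset.sum_singleton, pathWeight, upCells_singleton]
    simp [he]
  · rw [if_neg he, add_zero, add_div]
    -- The guard `s.2 < j` also excludes `j = 0`, where the truncated `j - 1` would give back the
    -- cell itself.
    have hsplit : paths lam s (i, j) =
        ((if s.2 < j then paths lam s (i, j - 1) else ∅).image (insert (i, j))) ∪
          (paths lam s (i + 1, j)).image (insert (i, j)) := by
      ext γ
      rw [mem_paths hs, Finset.mem_union, Finset.mem_image, Finset.mem_image]
      constructor
      · intro h
        generalize hx : (i, j) = x at h he
        cases h with
        | start => exact (he rfl).elim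
        | up a b γ h =>
          obtain ⟨rfl, rfl⟩ := Prod.mk.inj hx
          exact Or.inr ⟨γ, (mem_paths hs).2 h, rfl⟩
        | right a b γ _ h =>
          obtain ⟨rfl, rfl⟩ := Prod.mk.inj hx
          have := (h.bounds _ h.start_mem).2.2.2
          simp only at this
          refine Or.inl ⟨γ, ?_, rfl⟩
          rw [if_pos (by omega), mem_paths hs]
          exact h
      · rintro (⟨γ', h, rfl⟩ | ⟨γ', h, rfl⟩)
        · split_ifs at h with hj
          · obtain ⟨b, rfl⟩ : ∃ b, j = b + 1 := ⟨j - 1, by omega⟩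
            rw [mem_paths hs] at h
            exact h.right _ _ _ hij
          · simp at h
        · rw [mem_paths hs] at h
          exact h.up _ _ _
    have hdisj : Disjoint ((if s.2 < j then paths lam s (i, j - 1) else ∅).image (insert (i, j)))
        ((paths lam s (i + 1, j)).image (insert (i, j))) := by
      rw [Finset.disjoint_left]
      intro γ h1 h2
      obtain ⟨γ₁, h3, rfl⟩ := Finset.mem_image.1 h1
      obtain ⟨γ₂, h4, h5⟩ := Finset.mem_image.1 h2
      split_ifs at h3 with hj
      · rw [mem_paths hs] at h3 h4
        have h6 := h4.end_mem
        have h7 : (i + 1, j) ∈ insert (i, j) γ₁ := h5 ▸ Finset.mem_insert_of_mem h6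
        rw [Finset.mem_insert, or_iff_right (by simp)] at h7
        have := (h3.bounds _ h7).2.2.2
        simp only at this
        omega
      · simp at h3
    have hinj : ∀ γ₁ γ₂ : Finset (ℕ × ℕ), (i, j) ∉ γ₁ → (i, j) ∉ γ₂ →
        insert (i, j) γ₁ = insert (i, j) γ₂ → γ₁ = γ₂ := by
      intro γ₁ γ₂ h1 h2 h
      rw [← Finset.erase_insert h1, ← Finset.erase_insert h2, h]
    rw [pathSum, hsplit, Finset.sum_union hdisj]
    congr 1
    · split_ifs with hj
      · obtain ⟨b, rfl⟩ : ∃ b, j = b + 1 := ⟨j - 1, by omega⟩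
        simp only [Nat.add_sub_cancel]
        rw [Finset.sum_image, pathSum, Finset.sum_div]
        · exact Finset.sum_congr rfl fun γ hγ => hright b γ rfl ((mem_paths hs).1 hγ)
        · intro γ₁ h1 γ₂ h2 h
          rw [Finset.mem_coe, mem_paths hs] at h1 h2
          exact hinj _ _ h1.upCells_right.1 h2.upCells_right.1 h
      · simp
    · rw [Finset.sum_image, pathSum, Finset.sum_mul, Finset.sum_div]
      · exact Finset.sum_congr rfl fun γ hγ => hup γ ((mem_paths hs).1 hγ)
      · intro γ₁ h1 γ₂ h2 h
        rw [Finset.mem_coe, mem_paths hs] at h1 h2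
        exact hinj _ _ h1.upCells_up.1 h2.upCells_up.1 h

open Classical in
/-- The weight with which the paths enter the cell `(i, j)` from below or start there. -/
def entryWeight (q : K) (T : HangingTrees lam mu V) (s : ℕ × ℕ) (i j : ℕ) : K :=
  pathSum q T s (i + 1, j) * q ^ mobileHook T (i + 1, j) + if (i, j) = s then 1 else 0

/-- The state of the path sums below row `i`, for the columns `s.2, …, s.2 + m`. -/
def rowState (q : K) (T : HangingTrees lam mu V) (s : ℕ × ℕ) (i : ℕ) : ℕ → List (K × K)
  | 0 => [(q ^ sizeUpTo T (colContent lam s.2 - 1), entryWeight q T s i s.2)]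
  | m + 1 => (q ^ sizeUpTo T (colContent lam (s.2 + m + 1) - 1),
      entryWeight q T s i (s.2 + m + 1)) :: rowState q T s i m

/-- By `mobileHook_add` the recursion of `rowSum` is that of `pathSum` along row `i`, the entries of
the state being what comes from below or starts there. -/
lemma StripEnds.rowSum_rowState (E : StripEnds lam mu s t n) (hq0 : q ≠ 0) {i m : ℕ}
    (hi : t.1 ≤ i) (hm : (i, s.2 + m) ∈ lam) :
    rowSum (q ^ sizeUpTo T (rowContent lam i)) (rowState q T s i m) =
      pathSum q T s (i, s.2 + m) := by
  have hs := (mem_skewCells.1 E.start_mem).1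
  have hd : ∀ j, (i, j) ∈ lam → s.2 ≤ j → q ^ sizeUpTo T (rowContent lam i) /
      q ^ sizeUpTo T (colContent lam j - 1) = q ^ mobileHook T (i, j) := fun j hj hsj => by
    rw [← E.mobileHook_add hj hi hsj, pow_add, mul_div_cancel_right₀ _ (pow_ne_zero _ hq0)]
  induction m with
  | zero =>
    rw [rowState, rowSum, rowSum, hd s.2 hm le_rfl, pathSum_rec hs hm, if_neg (by simp),
      entryWeight]
    rfl
  | succ m ih =>
    rw [rowState, rowSum, ih (lam.up_left_mem le_rfl (by omega) hm),
      hd (s.2 + m + 1) hm (by omega), pathSum_rec hs hm, if_pos (by omega), entryWeight]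
    rfl

lemma StripEnds.nextRow_rowState (E : StripEnds lam mu s t n) (hq0 : q ≠ 0) {i m : ℕ}
    (hi : t.1 ≤ i + 1) (his : i < s.1) (hm : (i + 1, s.2 + m) ∈ lam) :
    nextRow (q ^ sizeUpTo T (rowContent lam (i + 1))) (rowState q T s (i + 1) m) =
      rowState q T s i m := by
  have hd : ∀ j, (i + 1, j) ∈ lam → s.2 ≤ j → q ^ sizeUpTo T (rowContent lam (i + 1)) /
      q ^ sizeUpTo T (colContent lam j - 1) = q ^ mobileHook T (i + 1, j) := fun j hj hsj => by
    rw [← E.mobileHook_add hj hi hsj, pow_add, mul_div_cancel_right₀ _ (pow_ne_zero _ hq0)]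
  have hne : ∀ j, (i, j) ≠ s := by
    rintro j rfl
    exact lt_irrefl _ his
  induction m with
  | zero =>
    have h := E.rowSum_rowState (T := T) hq0 hi hm
    rw [rowState] at h
    rw [rowState, nextRow, nextRow, h, hd s.2 hm le_rfl, rowState]
    simp [entryWeight, hne]
  | succ m ih =>
    have h := E.rowSum_rowState (T := T) hq0 hi hm
    rw [rowState] at h
    rw [rowState, nextRow, ih (lam.up_left_mem le_rfl (by omega) hm), h,
      hd (s.2 + m + 1) hm (by omega), rowState]
    simp [entryWeight, hne, add_assoc]

/-- Following the strip up to `c` produces the path sums in the whole part of λ that the strip has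
bounded so far: a step to the right opens a column, a step upwards completes a row. -/
lemma StripEnds.stripState_eq (E : StripEnds lam mu s t n) (hq0 : q ≠ 0) {k : ℕ} {c : ℕ × ℕ}
    (hc : c ∈ skewCells lam mu) (hk : idx s c = k) :
    stripState (fun k => q ^ sizeBefore T s k) (upSteps lam mu s) k =
      rowState q T s c.1 (c.2 - s.2) := by
  have hs := (mem_skewCells.1 E.start_mem).1
  induction k generalizing c with
  | zero =>
    obtain rfl : c = s := E.idx_inj hc E.start_mem (by rw [hk, idx_start])
    have h1 : colContent lam c.2 - 1 = content c + (0 : ℕ) - 1 := by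
      rw [colContent, colLen_eq hs E.start_below, content]
      push_cast
      ring
    rw [Nat.sub_self, rowState, stripState, h1, E.sizeUpTo_eq, entryWeight,
      pathSum_eq_zero hs (by simp)]
    simp
  | succ k ih =>
    have hn := E.idx_le hc
    obtain ⟨d, hd, hdk⟩ := E.exists_idx_eq (k := k) (by omega)
    have hsd := E.strip.of_content_le E.start_mem hd (E.start_le d hd)
    have hcl := (mem_skewCells.1 hc).1
    have hdl := (mem_skewCells.1 hd).1
    have hdc := E.content_eq hd
    have hmem : k ∈ upSteps lam mu s ↔ 1 ≤ d.1 ∧ (d.1 - 1, d.2) ∈ skewCells lam mu := by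
      rw [← hdk]
      exact E.idx_mem_upSteps hd
    obtain ⟨m, hm⟩ : ∃ m, d.2 = s.2 + m := ⟨d.2 - s.2, by omega⟩
    rw [stripState, ih hd hdk]
    rcases E.of_idx_eq_add_one hd hc (by omega) with rfl | rfl
    · have hrim : (d.1 + 1, d.2 + 1) ∉ lam := E.strip.not_mem_of_mem_skewCells hd
      have h1 : ¬ (1 ≤ d.1 ∧ (d.1 - 1, d.2) ∈ skewCells lam mu) := by
        rintro ⟨h1, h2⟩
        have h3 := E.strip.not_mem_of_mem_skewCells h2
        rw [Nat.sub_add_cancel h1] at h3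
        exact h3 hcl
      -- The bottom cell of the new column is at position `k + 1`. Nothing enters from below,
      -- because the cell under it is outside λ.
      have h2 : colContent lam (s.2 + m + 1) - 1 = content s + (k + 1 : ℕ) - 1 := by
        rw [← hm, colContent, colLen_eq hcl hrim]
        rw [content, hdk] at hdc
        push_cast
        omega
      have h3 : d.2 + 1 - s.2 = m + 1 := by omega
      have h4 : (d.1, s.2 + m + 1) ≠ s := fun h => by
        have := congrArg Prod.snd h
        simp only at this
        omega
      rw [if_neg (hmem.not.2 h1)]
      simp only
      rw [h3, rowState, h2, E.sizeUpTo_eq, entryWeight, if_neg h4, ← hm,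
        pathSum_eq_zero hs (Or.inl hrim), hm, Nat.add_sub_cancel_left]
      simp
    · have hrim : (c.1 + 1, c.2 + 1) ∉ lam := E.strip.not_mem_of_mem_skewCells hc
      have h1 : k ∈ upSteps lam mu s := hmem.2 ⟨by simp, by simpa using hc⟩
      -- The completed row ends at position `k`, so its parameter counts the positions before `k +
      -- 1`.
      have h2 : content s + (k + 1 : ℕ) - 1 = rowContent lam (c.1 + 1) := by
        rw [rowContent, rowLen_eq hdl hrim]
        rw [content, hdk] at hdc
        push_cast at hdc ⊢
        omega
      have htc := E.strip.of_content_le hc E.end_mem (E.le_end c hc)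
      simp only at hm hsd
      rw [if_pos h1, ← E.sizeUpTo_eq, h2]
      simp only [hm, Nat.add_sub_cancel_left]
      exact E.nextRow_rowState hq0 (by omega) (by omega) (by rw [← hm]; exact hdl)

lemma StripEnds.rowSum_stripState (E : StripEnds lam mu s t n) (hq0 : q ≠ 0) :
    rowSum (q ^ sizeBefore T s (n + 1))
      (stripState (fun k => q ^ sizeBefore T s k) (upSteps lam mu s) n) = pathSum q T s t := by
  have htl := (mem_skewCells.1 E.end_mem).1
  have hst := E.strip.of_content_le E.start_mem E.end_mem (E.start_le t E.end_mem)
  have h1 : content s + (n + 1 : ℕ) - 1 = rowContent lam t.1 := by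
    have := E.content_end
    rw [rowContent, rowLen_eq htl E.end_right]
    simp only [content] at this ⊢
    push_cast
    omega
  have h2 : s.2 + (t.2 - s.2) = t.2 := by omega
  rw [E.stripState_eq hq0 E.end_mem E.idx_end, ← E.sizeUpTo_eq, h1,
    E.rowSum_rowState hq0 le_rfl (by rw [h2]; exact htl), h2]

end Hooks

/-! ### The exponents -/

section Exponents

variable {lam mu : YoungDiagram} {V : Type*} [PartialOrder V] [Fintype V]
  {T : HangingTrees lam mu V} {s t e : ℕ × ℕ} {n : ℕ} {γ : Finset (ℕ × ℕ)}

open Classical in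
/-- The number of vertices that hang in the rows above row `i`. -/
def treesAbove (T : HangingTrees lam mu V) (i : ℕ) : ℕ :=
  (Finset.univ.filter fun v : V => (T.cell v).1 < i).card

open Classical in
/-- The number of vertices that hang on the cells to the south-east of `c`. -/
def treesSouthEast (T : HangingTrees lam mu V) (c : ℕ × ℕ) : ℕ :=
  (Finset.univ.filter fun v : V => c ≤ T.cell v).card

lemma mobileHook_eq (c : ℕ × ℕ) : mobileHook T c = hook lam c + treesSouthEast T c := by
  rw [mobileHook, treesSouthEast]

/-- A tree in a row above `u` hangs in a column weakly to the right of `u`; otherwise `u` would be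
strictly south-east of a cell of the rim. -/
lemma treesFrom_eq (h : IsBorderStrip lam mu) {u : ℕ × ℕ} (hu : u ∈ lam) :
    treesFrom T u.2 = treesSouthEast T u + treesAbove T u.1 := by
  classical
  rw [treesFrom, treesSouthEast, treesAbove, ← Finset.card_union_of_disjoint]
  · congr 1
    ext v
    simp only [Finset.mem_union, Finset.mem_filter, Finset.mem_univ, true_and, Prod.le_def]
    refine ⟨fun h1 => ?_, fun h1 => ?_⟩
    · rcases le_or_gt u.1 (T.cell v).1 with h2 | h2
      · exact Or.inl ⟨h2, h1⟩
      · exact Or.inr h2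
    · rcases h1 with h1 | h1
      · exact h1.2
      · by_contra hcon
        exact h.not_mem_of_mem_skewCells (i := (T.cell v).1) (j := (T.cell v).2) (T.cell_mem v)
          (lam.up_left_mem (i2 := u.1) (j2 := u.2) h1 (not_le.1 hcon) hu)
  · rw [Finset.disjoint_left]
    intro v hv hv'
    have h1 := (Finset.mem_filter.1 hv).2.1
    have h2 := (Finset.mem_filter.1 hv').2
    omega

/-- A path has one cell more in each column than it has upward steps there. -/
lemma IsPath.sum_columns {M : Type*} [AddCommMonoid M] (h : IsPath lam s e γ) (F : ℕ → M) :
    ∑ u ∈ γ, F u.2 = ∑ u ∈ upCells γ, F u.2 + ∑ j ∈ Finset.Icc s.2 e.2, F j := by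
  induction h with
  | start => simp [upCells_singleton]
  | up i j γ h ih =>
    obtain ⟨h1, h2, h3⟩ := h.upCells_up
    rw [h3, Finset.sum_insert h1, Finset.sum_insert h2, ih, add_assoc]
  | right i j γ _ h ih =>
    obtain ⟨h1, h2⟩ := h.upCells_right
    have := (h.bounds _ h.start_mem).2.2.2
    simp only at this
    rw [h2, Finset.sum_insert h1, ih, Finset.sum_Icc_succ_top (by omega), add_comm, add_assoc]

/-- A path has one upward step from each row except the last one. -/
lemma IsPath.sum_rows {M : Type*} [AddCommMonoid M] (h : IsPath lam s e γ) (F : ℕ → M) :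
    ∑ u ∈ upCells γ, F u.1 = ∑ i ∈ Finset.Ioc e.1 s.1, F i := by
  induction h with
  | start => simp [upCells_singleton]
  | up i j γ h ih =>
    obtain ⟨h1, h2, h3⟩ := h.upCells_up
    have := (h.bounds _ h.start_mem).1
    simp only at this
    rw [h3, Finset.sum_insert h2, ih]
    have e : Finset.Ioc i s.1 = insert (i + 1) (Finset.Ioc (i + 1) s.1) := by
      ext k
      simp only [Finset.mem_Ioc, Finset.mem_insert]
      omega
    simp only
    rw [e, Finset.sum_insert (by simp)]
  | right i j γ _ h ih =>
    rw [h.upCells_right.2, ih]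

/-- An upward cell `u` of the strip is paired with the cell above it. No cell of λ is to the right
of `u`, so the trees south-east of `u` are those strictly below the upper cell in the same column.
-/
lemma StripEnds.sum_treesBelow (E : StripEnds lam mu s t n) :
    ∑ c ∈ skewCells lam mu, treesBelow T c =
      ∑ u ∈ upCells (skewCells lam mu), treesSouthEast T u := by
  classical
  rw [← Finset.sum_filter_of_ne (p := fun c => (c.1 + 1, c.2) ∈ skewCells lam mu)]
  · symm
    refine Finset.sum_nbij' (fun u => (u.1 - 1, u.2)) (fun c => (c.1 + 1, c.2)) ?_ ?_ ?_ ?_ ?_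
    · intro u hu
      obtain ⟨h1, h2, h3⟩ := mem_upCells.1 hu
      refine Finset.mem_filter.2 ⟨h3, ?_⟩
      simp only [Nat.sub_add_cancel h2]
      exact h1
    · intro c hc
      obtain ⟨h1, h2⟩ := Finset.mem_filter.1 hc
      exact mem_upCells.2 ⟨h2, by simp, by simpa using h1⟩
    · intro u hu
      obtain ⟨h1, h2, h3⟩ := mem_upCells.1 hu
      simp [Nat.sub_add_cancel h2]
    · intro c hc
      simp
    · intro u hu
      obtain ⟨h1, h2, h3⟩ := mem_upCells.1 hu
      rw [treesSouthEast, treesBelow]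
      congr 1
      ext v
      simp only [Finset.mem_filter, Finset.mem_univ, true_and, Prod.le_def]
      constructor
      · rintro ⟨h4, h5⟩
        refine ⟨le_antisymm ?_ h5, by omega⟩
        by_contra hcon
        have h6 := E.strip.not_mem_of_mem_skewCells h3
        rw [Nat.sub_add_cancel h2] at h6
        exact h6 (lam.up_left_mem (i2 := (T.cell v).1) (j2 := (T.cell v).2) h4 (by omega)
          (mem_skewCells.1 (T.cell_mem v)).1)
      · rintro ⟨h4, h5⟩
        omega
  · intro c hc hne
    obtain ⟨v, hv⟩ := Finset.card_pos.1 (Nat.pos_of_ne_zero hne)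
    obtain ⟨-, h1, h2⟩ := Finset.mem_filter.1 hv
    exact mem_skewCells_of_le hc (T.cell_mem v) ⟨by simp, le_rfl⟩ ⟨h2, h1.ge⟩

/-- The exponent of an excited diagram in terms of its path. -/
lemma StripEnds.exponent_eq (E : StripEnds lam mu s t n) (hγ : IsPath lam s t γ) :
    (weight lam mu (lam.cells \ γ) : ℤ) + correction T (lam.cells \ γ) =
      (∑ u ∈ upCells γ, mobileHook T u : ℕ) - (∑ c ∈ skewCells lam mu, treesBelow T c : ℕ) := by
  have hs := (mem_skewCells.1 E.start_mem).1
  obtain ⟨B, hB⟩ := E.excited_of_isPath hγ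
  have hsd : lam.cells \ (lam.cells \ γ) = γ := Finset.sdiff_sdiff_eq_self (hγ.subset hs)
  have hup : ∀ {γ : Finset (ℕ × ℕ)}, IsPath lam s t γ → ∀ u ∈ upCells γ, u ∈ lam := by
    intro γ h u hu
    have := h.subset hs (mem_upCells.1 hu).1
    rwa [YoungDiagram.mem_cells] at this
  have hσ := E.isPath_skewCells
  -- Apart from their upward steps, `γ` and the strip contribute the same sum over columns, and the
  -- terms `treesAbove` sum over the same rows. Hence p_D is the sum of `treesSouthEast` over the
  -- upward steps of `γ` minus that for the strip.
  have e1 := hγ.sum_columns fun j => (treesFrom T j : ℤ)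
  have e2 := hσ.sum_columns fun j => (treesFrom T j : ℤ)
  have e3 := hγ.sum_rows fun i => (treesAbove T i : ℤ)
  have e4 := hσ.sum_rows fun i => (treesAbove T i : ℤ)
  have e5 : ∑ u ∈ upCells γ, (treesFrom T u.2 : ℤ) =
      ∑ u ∈ upCells γ, (treesSouthEast T u : ℤ) + ∑ u ∈ upCells γ, (treesAbove T u.1 : ℤ) := by
    rw [← Finset.sum_add_distrib]
    refine Finset.sum_congr rfl fun u hu => ?_
    rw [treesFrom_eq E.strip (hup hγ u hu)]
    push_cast
    rfl
  have e6 : ∑ u ∈ upCells (skewCells lam mu), (treesFrom T u.2 : ℤ) =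
      ∑ u ∈ upCells (skewCells lam mu), (treesSouthEast T u : ℤ) +
        ∑ u ∈ upCells (skewCells lam mu), (treesAbove T u.1 : ℤ) := by
    rw [← Finset.sum_add_distrib]
    refine Finset.sum_congr rfl fun u hu => ?_
    rw [treesFrom_eq E.strip (hup hσ u hu)]
    push_cast
    rfl
  rw [weight, correction, E.brokenDiagonals_eq hB, hsd, E.sum_treesBelow]
  simp only [mobileHook_eq]
  push_cast
  rw [Finset.sum_add_distrib]
  linarith

end Exponents

end MobileTree

end

theorem mainTheorem2 {V : Type*} [Fintype V] [PartialOrder V]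
    (lam mu : YoungDiagram) (hstrip : MobileTree.IsBorderStrip lam mu)
    (T : MobileTree.HangingTrees lam mu V)
    (ω : MobileTree.Mobile T ≃ Fin (Fintype.card (MobileTree.Mobile T)))
    (hω : MobileTree.IsInvLabeling T ω) :
    MobileTree.eInv ω /
        ∏ i ∈ Finset.Icc 1 (Fintype.card (MobileTree.Mobile T)), (1 - (RatFunc.X : RatFunc ℚ) ^ i) =
      (∏ v : V, 1 / (1 - (RatFunc.X : RatFunc ℚ) ^ MobileTree.treeHook v)) *
        ∑ D ∈ MobileTree.excitedDiagrams lam mu,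
          (RatFunc.X : RatFunc ℚ) ^
              ((MobileTree.weight lam mu D : ℤ) + MobileTree.correction T D) *
            ∏ u ∈ lam.cells \ D, 1 / (1 - (RatFunc.X : RatFunc ℚ) ^ MobileTree.mobileHook T u) := by
  obtain ⟨s, t, n, E⟩ := hstrip.exists_stripEnds
  have hs := (MobileTree.mem_skewCells.1 E.start_mem).1
  have hq := MobileTree.one_sub_X_pow_ne_zero
  have hX : (RatFunc.X : RatFunc ℚ) ≠ 0 := RatFunc.X_ne_zero
  have hprod : ∏ i ∈ Finset.Icc 1 (Fintype.card (MobileTree.Mobile T)),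
      (1 - (RatFunc.X : RatFunc ℚ) ^ i) ≠ 0 :=
    Finset.prod_ne_zero_iff.2 fun i hi => hq i (Finset.mem_Icc.1 hi).1
  have key := MobileTree.normSum_mobile E hω hX hq
  rw [E.rowSum_stripState hX] at key
  rw [MobileTree.eInv_eq_normSum, mul_div_cancel_right₀ _ hprod, E.sum_excitedDiagrams]
  -- This power of q comes from passing to the block labeling; it cancels the constant subtracted in
  -- `exponent_eq`.
  apply mul_left_cancel₀
    (pow_ne_zero (∑ c ∈ MobileTree.skewCells lam mu, MobileTree.treesBelow T c) hX)
  rw [key, mul_left_comm, MobileTree.pathSum]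
  congr 1
  rw [Finset.mul_sum]
  refine Finset.sum_congr rfl fun γ hγ => ?_
  rw [MobileTree.mem_paths hs] at hγ
  rw [E.exponent_eq hγ, zpow_sub₀ hX, zpow_natCast, zpow_natCast,
    Finset.sdiff_sdiff_eq_self (hγ.subset hs), MobileTree.pathWeight, Finset.prod_pow_eq_pow_sum,
    ← mul_assoc, mul_div_cancel₀ _ (pow_ne_zero _ hX)]
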